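/- Let $n\ge 1$, $A\ge 0$ and $0<\lambda\le\Lambda$. For $v:\mathbb R^n\to\mathbb R$ put $\delta v(x,y)=v(x+y)+v(x-y)-2v(x)$ and $$M^+v(x)=\frac12\int_{\mathbb R^n}\frac{\Lambda\,\delta v(x,y)^+-\lambda\,\delta v(x,y)^-}{|y|^{n+1}}\,dy,\qquad M^-v(x)=\frac12\int_{\mathbb R^n}\frac{\lambda\,\delta v(x,y)^+-\Lambda\,\delta v(x,y)^-}{|y|^{n+1}}\,dy .$$ Let $T>0$. A continuous function $u$ on $\mathbb R^n\times[0,T]$ satisfies $u_t-A|\nabla u|-M^+u\le 0$ (respectively $u_t+A|\nabla u|-M^-u\ge 0$) in the viscosity sense in $\mathbb R^n\times[0,T]$ if the following holds for all $x\in\mathbb R^n$, $0<t\le T$, $r>0$ and every $C^2$ function $\varphi:\mathbb R^n\times\mathbb R\to\mathbb R$: whenever $\varphi(x,t)=u(x,t)$ and $\varphi(y,s)\ge u(y,s)$ (respectively $\varphi(y,s)\le u(y,s)$) for all $|y-x|<r$ and $s\in(t-r,t]$ with $s\ge0$, the function $v$ equal to $\varphi$ in $B_r(x)\times(t-r,t+r)$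 and to $u$ elsewhere satisfies $v_t-A|\nabla v|-M^+v\le 0$ (respectively $v_t+A|\nabla v|-M^-v\ge 0$) at $(x,t)$, where $M^\pm$ act in the space variable. Theorem (Hölder continuity for advection-diffusion equations). There are constants $\alpha\in(0,1)$ and $C>0$, depending only on $A,n,\lambda,\Lambda$, such that for every $T>0$ and every bounded continuous function $u$ on $\mathbb R^n\times[0,T]$ which satisfies, in the viscosity sense in $\mathbb R^n\times[0,T]$, both $$u_t-A|\nabla u|-M^+u\le 0\qquad\text{and}\qquad u_t+A|\nabla u|-M^-u\ge 0,$$ the following holds for every $0<t\le T$. First, $$|u(x,t)-u(y,s)|\le C\,\|u(\cdot,0)\|_{L^\infty}\,\frac{|x-y|^\alpha+|t-s|^\alpha}{t^\alpha}\qquad\text{for all }x,y\in\mathbb R^n,\ 0\le s\le t .$$ Second, $u$ is $C^\alpha$ on $\mathbb R^n\times[t/2,t]$, with $|u|\le C\|u(\cdot,0)\|_{L^\infty}$ there and $$|u(x,s)-u(y,s')|\le \frac{C}{t^{\alpha}}\,\|u(\cdot,0)\|_{L^\infty}\,\bigl(|x-y|^\alpha+|s-s'|^\alpha\bigr)\qquad\text{for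 all }x,y\in\mathbb R^n,\ s,s'\in[t/2,t].$$ -/

import Mathlib

open MeasureTheory Set

noncomputable section

/-- The second order symmetric increment `δu(x,y) = u(x+y) + u(x-y) - 2 u(x)`. -/
def secondDiff {n : ℕ} (u : EuclideanSpace ℝ (Fin n) → ℝ)
    (x y : EuclideanSpace ℝ (Fin n)) : ℝ :=
  u (x + y) + u (x - y) - 2 * u x

/-- The maximal nonlocal Pucci operator of order one, with ellipticity constants `l ≤ L`. -/
def pucciMax {n : ℕ} (l L : ℝ) (u : EuclideanSpace ℝ (Fin n) → ℝ)
    (x : EuclideanSpace ℝ (Fin n)) : ℝ :=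
  (1 / 2) * ∫ y : EuclideanSpace ℝ (Fin n),
    (L * max (secondDiff u x y) 0 - l * max (-secondDiff u x y) 0) / ‖y‖ ^ (n + 1)

/-- The minimal nonlocal Pucci operator of order one, with ellipticity constants `l ≤ L`. -/
def pucciMin {n : ℕ} (l L : ℝ) (u : EuclideanSpace ℝ (Fin n) → ℝ)
    (x : EuclideanSpace ℝ (Fin n)) : ℝ :=
  (1 / 2) * ∫ y : EuclideanSpace ℝ (Fin n),
    (l * max (secondDiff u x y) 0 - L * max (-secondDiff u x y) 0) / ‖y‖ ^ (n + 1)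

open Classical in
/-- The function equal to `φ` in `B_r(x) × (t-r, t+r)` and to `u` elsewhere. -/
def patch {n : ℕ} (φ u : EuclideanSpace ℝ (Fin n) → ℝ → ℝ)
    (x : EuclideanSpace ℝ (Fin n)) (t r : ℝ) : EuclideanSpace ℝ (Fin n) → ℝ → ℝ :=
  fun y s => if y ∈ Metric.ball x r ∧ s ∈ Ioo (t - r) (t + r) then φ y s else u y s

/-- `u` satisfies `u_t - A |∇u| - M⁺ u ≤ 0` in the viscosity sense in `ℝⁿ × [0,T]`. The values
of `u` at times outside `[0,T]` are irrelevant. The inequality is tested at positive times, and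
touching involves only the times `s ≤ t`. Since `φ` is `C²` (and `u` is bounded and continuous
where this is used), all terms evaluated at the point `(x,t)` exist in the classical sense. -/
structure IsViscositySubsolution {n : ℕ} (A l L T : ℝ)
    (u : EuclideanSpace ℝ (Fin n) → ℝ → ℝ) : Prop where
  upperSemicontinuousOn :
    UpperSemicontinuousOn (Function.uncurry u) (univ ×ˢ Icc (0 : ℝ) T)
  test : ∀ φ : EuclideanSpace ℝ (Fin n) → ℝ → ℝ, ContDiff ℝ 2 (Function.uncurry φ) →
    ∀ (x : EuclideanSpace ℝ (Fin n)) (t r : ℝ), 0 < t → t ≤ T → 0 < r →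
    φ x t = u x t →
    (∀ y s, y ∈ Metric.ball x r → t - r < s → s ≤ t → 0 ≤ s → u y s ≤ φ y s) →
    deriv (fun s => patch φ u x t r x s) t
      - A * ‖gradient (fun y => patch φ u x t r y t) x‖
      - pucciMax l L (fun y => patch φ u x t r y t) x ≤ 0

/-- `u` satisfies `u_t + A |∇u| - M⁻ u ≥ 0` in the viscosity sense in `ℝⁿ × [0,T]`. -/
structure IsViscositySupersolution {n : ℕ} (A l L T : ℝ)
    (u : EuclideanSpace ℝ (Fin n) → ℝ → ℝ) : Prop where
  lowerSemicontinuousOn :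
    LowerSemicontinuousOn (Function.uncurry u) (univ ×ˢ Icc (0 : ℝ) T)
  test : ∀ φ : EuclideanSpace ℝ (Fin n) → ℝ → ℝ, ContDiff ℝ 2 (Function.uncurry φ) →
    ∀ (x : EuclideanSpace ℝ (Fin n)) (t r : ℝ), 0 < t → t ≤ T → 0 < r →
    φ x t = u x t →
    (∀ y s, y ∈ Metric.ball x r → t - r < s → s ≤ t → 0 ≤ s → φ y s ≤ u y s) →
    0 ≤ deriv (fun s => patch φ u x t r x s) t
      + A * ‖gradient (fun y => patch φ u x t r y t) x‖
      - pucciMin l L (fun y => patch φ u x t r y t) x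

end

/-! The diffusion has order one, the same as the drift and the time derivative, so the equations
keep their constants under `(x,t) ↦ (ρx, ρt)` and under affine changes of the values. Hölder
regularity therefore reduces to one scale-invariant step of oscillation decay. `TouchBound` extracts
from the viscosity definition the only information needed: at a point where a smooth function
touches from above, the mass of the gap between the two enters the inequality with a favourable
sign. `TouchBound.affine` records the scaling invariance.

Comparison (`TouchBound.le_barrier`) is made with `M + ε growth + ε C t - m(t) bump`. The sublinear
`growth` forces the maximum to be attained, and its cost is paid by the lift `ε C t`. The gradient
and second differences of `bump` are controlled by `bump` itself, so the cost of the last term is a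
linear decay of `m`; since `bump` also lies below the nonlocal kernel, up to a constant, any mass
missing from the unit ball makes `m` grow. With `m = 0` this gives the maximum principle
`TouchBound.le_of_initial`.

If `|v| ≤ 1 + ε growth` on `[0,1]`, the deficits of `v` and `-v` in the unit ball add up to at least
twice its volume (`IsTrapped.deficit_dichotomy`), so one of them is large over `[0,1/2]` and pushes
`v` or `-v` down by a multiple of `bump` on `[1/2,1]` (`IsTrapped.le_sub_bump`). Zooming in by `R⁻²`
and enlarging the values by `(1 - ε/2)⁻¹` returns to the same class (`IsTrapped.rescale_of_le`): far
away, the zoom shrinks `growth` enough to absorb the enlargement. Iteration gives geometric decay of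
the oscillation at `(0,1)`, and scaling carries this to every point. -/

/-- The growth function `(1 + |x|²)^{1/4} - 1`. -/
noncomputable def growth {n : ℕ} (x : EuclideanSpace ℝ (Fin n)) : ℝ :=
  √(√(1 + ‖x‖ ^ 2)) - 1

/-- The bump `(1 + |x|²)^{-(n+1)}`. -/
noncomputable def bump {n : ℕ} (x : EuclideanSpace ℝ (Fin n)) : ℝ :=
  (1 + ‖x‖ ^ 2)⁻¹ ^ (n + 1)

/-- The kernel `min (|y|^{1/2}, |y|²) / |y|^{n+1}`. -/
noncomputable def kern {n : ℕ} (y : EuclideanSpace ℝ (Fin n)) : ℝ :=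
  min (√‖y‖) (‖y‖ ^ 2) / ‖y‖ ^ (n + 1)

/-! ### Estimates for the barriers and the kernel. -/

section Barriers

variable {n : ℕ}

theorem contDiff_growth : ContDiff ℝ 2 (growth : EuclideanSpace ℝ (Fin n) → ℝ) := by
  have h : ContDiff ℝ 2 (fun x : EuclideanSpace ℝ (Fin n) => 1 + ‖x‖ ^ 2) :=
    contDiff_const.add (contDiff_norm_sq ℝ)
  have h1 : ∀ x : EuclideanSpace ℝ (Fin n), 1 + ‖x‖ ^ 2 ≠ 0 := fun x => by positivity
  have h2 := h.sqrt h1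
  exact (h2.sqrt (fun x => by positivity)).sub contDiff_const

theorem contDiff_bump : ContDiff ℝ 2 (bump : EuclideanSpace ℝ (Fin n) → ℝ) := by
  have h : ContDiff ℝ 2 (fun x : EuclideanSpace ℝ (Fin n) => 1 + ‖x‖ ^ 2) :=
    contDiff_const.add (contDiff_norm_sq ℝ)
  exact (h.inv (fun x => by positivity)).pow _

theorem growth_nonneg (x : EuclideanSpace ℝ (Fin n)) : 0 ≤ growth x := by
  have h : (1 : ℝ) ≤ √(√(1 + ‖x‖ ^ 2)) := by
    rw [Real.one_le_sqrt, Real.one_le_sqrt]; nlinarith [sq_nonneg ‖x‖]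
  unfold growth; linarith

theorem bump_pos (x : EuclideanSpace ℝ (Fin n)) : 0 < bump x := by
  unfold bump; positivity

theorem bump_le_one (x : EuclideanSpace ℝ (Fin n)) : bump x ≤ 1 := by
  unfold bump
  refine pow_le_one₀ (by positivity) (inv_le_one_of_one_le₀ ?_)
  nlinarith [sq_nonneg ‖x‖]

theorem sqrt_add_sqrt_le {a b : ℝ} (ha : 0 ≤ a) (hb : 0 ≤ b) :
    √a + √b ≤ 2 * √((a + b) / 2) := by
  have h1 := Real.sq_sqrt ha
  have h2 := Real.sq_sqrt hb
  have h3 : (√a + √b) / 2 ≤ √((a + b) / 2) := by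
    apply Real.le_sqrt_of_sq_le
    nlinarith [sq_nonneg (√a - √b)]
  linarith

theorem sqrt_add_le_sqrt_add {p q : ℝ} (hp : 1 ≤ p) (hq : 0 ≤ q) : √(p + q) ≤ √p + q := by
  have h1 := Real.sq_sqrt (by linarith : (0 : ℝ) ≤ p)
  have h2 : (1 : ℝ) ≤ √p := Real.one_le_sqrt.2 hp
  apply Real.sqrt_le_iff.2 ⟨by positivity, ?_⟩
  nlinarith

theorem sqrt_add_le_add_sqrt {p q : ℝ} (hp : 0 ≤ p) (hq : 0 ≤ q) : √(p + q) ≤ √p + √q := by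
  apply Real.sqrt_le_iff.2 ⟨by positivity, ?_⟩
  nlinarith [Real.sq_sqrt hp, Real.sq_sqrt hq, Real.sqrt_nonneg p, Real.sqrt_nonneg q]

/-- By the parallelogram law the average of `1 + |x ± y|²` is `1 + |x|² + |y|²`, and the fourth root
is concave. Subadditivity of the root then gives `|y|^{1/2}`, and its slope at most one beyond `1`
gives `|y|²`. The bound is uniform in `x` and integrable against the kernel. -/
theorem secondDiff_growth_le (x y : EuclideanSpace ℝ (Fin n)) :
    secondDiff growth x y ≤ 2 * min (√‖y‖) (‖y‖ ^ 2) := by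
  have hp := parallelogram_law_with_norm ℝ x y
  have h1 : √(√(1 + ‖x + y‖ ^ 2)) + √(√(1 + ‖x - y‖ ^ 2)) ≤
      2 * √(√(1 + ‖x‖ ^ 2 + ‖y‖ ^ 2)) := by
    refine (sqrt_add_sqrt_le (by positivity) (by positivity)).trans ?_
    gcongr
    have := sqrt_add_sqrt_le (a := 1 + ‖x + y‖ ^ 2) (b := 1 + ‖x - y‖ ^ 2)
      (by positivity) (by positivity)
    rw [show (1 + ‖x + y‖ ^ 2 + (1 + ‖x - y‖ ^ 2)) / 2 = 1 + ‖x‖ ^ 2 + ‖y‖ ^ 2 by linarith] at this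
    linarith
  have hone : (1 : ℝ) ≤ 1 + ‖x‖ ^ 2 := by nlinarith [sq_nonneg ‖x‖]
  have h2 : √(√(1 + ‖x‖ ^ 2 + ‖y‖ ^ 2)) ≤ √(√(1 + ‖x‖ ^ 2)) + √‖y‖ := by
    have := sqrt_add_le_add_sqrt (p := 1 + ‖x‖ ^ 2) (q := ‖y‖ ^ 2) (by positivity) (by positivity)
    rw [Real.sqrt_sq (norm_nonneg y)] at this
    exact (Real.sqrt_le_sqrt this).trans (sqrt_add_le_add_sqrt (by positivity) (by positivity))
  have h3 : √(√(1 + ‖x‖ ^ 2 + ‖y‖ ^ 2)) ≤ √(√(1 + ‖x‖ ^ 2)) + ‖y‖ ^ 2 :=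
    (Real.sqrt_le_sqrt (sqrt_add_le_sqrt_add hone (by positivity))).trans
      (sqrt_add_le_sqrt_add (Real.one_le_sqrt.2 hone) (by positivity))
  unfold secondDiff growth
  rcases min_cases (√‖y‖) (‖y‖ ^ 2) with ⟨h, _⟩ | ⟨h, _⟩ <;> rw [h] <;> linarith

theorem growth_add_le (x y : EuclideanSpace ℝ (Fin n)) :
    growth (x + y) ≤ growth x + ‖y‖ := by
  have hone : (1 : ℝ) ≤ 1 + ‖x‖ ^ 2 := by nlinarith [sq_nonneg ‖x‖]
  have h0 : √(1 + ‖x + y‖ ^ 2) ≤ √(1 + ‖x‖ ^ 2) + ‖y‖ := by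
    apply Real.sqrt_le_iff.2 ⟨by positivity, ?_⟩
    have h1 := Real.sq_sqrt (by linarith : (0 : ℝ) ≤ 1 + ‖x‖ ^ 2)
    have h2 : ‖x‖ ≤ √(1 + ‖x‖ ^ 2) := Real.le_sqrt_of_sq_le (by linarith)
    have h3 : ‖x + y‖ ^ 2 ≤ (‖x‖ + ‖y‖) ^ 2 := by gcongr; exact norm_add_le x y
    nlinarith [norm_nonneg y, mul_le_mul_of_nonneg_right h2 (norm_nonneg y)]
  have := (Real.sqrt_le_sqrt h0).trans
    (sqrt_add_le_sqrt_add (Real.one_le_sqrt.2 hone) (norm_nonneg y))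
  unfold growth; linarith

/-- The function grows like `|x|^{1/2}` at infinity and is quadratic at the origin, so contracting
by `R²` gains at least a factor `R`. In terms of `a = growth x + 1` and `b = growth (R⁻² x) + 1` one
has `a⁴ - 1 = R⁴ (b⁴ - 1)`, and the claim is a comparison of binomial coefficients. -/
theorem growth_inv_sq_smul_le {R : ℝ} (hR : 1 ≤ R) (x : EuclideanSpace ℝ (Fin n)) :
    R * growth ((R ^ 2)⁻¹ • x) ≤ growth x := by
  have hR0 : 0 < R := by linarith
  set s := ‖x‖ ^ 2 with hs
  have hs0 : 0 ≤ s := by positivity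
  have hsc : ‖(R ^ 2)⁻¹ • x‖ ^ 2 = s / R ^ 4 := by
    rw [norm_smul, mul_pow, Real.norm_of_nonneg (by positivity)]; field_simp; rfl
  unfold growth
  rw [hsc, ← hs]
  set a := √(√(1 + s)) with ha
  set b := √(√(1 + s / R ^ 4)) with hb
  have hone : (1 : ℝ) ≤ 1 + s / R ^ 4 := by
    have : 0 ≤ s / R ^ 4 := by positivity
    linarith
  have hb1 : 1 ≤ b := by rw [hb, Real.one_le_sqrt, Real.one_le_sqrt]; exact hone
  have ha1 : 1 ≤ a := by rw [ha, Real.one_le_sqrt, Real.one_le_sqrt]; linarith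
  have ha4 : a ^ 4 = 1 + s := by
    rw [show a ^ 4 = (a ^ 2) ^ 2 by ring, ha, Real.sq_sqrt (by positivity), Real.sq_sqrt (by linarith)]
  have hb4 : b ^ 4 = 1 + s / R ^ 4 := by
    rw [show b ^ 4 = (b ^ 2) ^ 2 by ring, hb, Real.sq_sqrt (by positivity), Real.sq_sqrt (by linarith)]
  have hkey : R ^ 4 * (b ^ 4 - 1) = a ^ 4 - 1 := by rw [ha4, hb4]; field_simp; ring
  by_contra hcon
  push Not at hcon
  have hab : a < 1 + R * (b - 1) := by linarith
  have : a ^ 4 < (1 + R * (b - 1)) ^ 4 := by gcongr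
  have h5 : (1 + R * (b - 1)) ^ 4 ≤ 1 + R ^ 4 * (b ^ 4 - 1) := by
    obtain ⟨c, h⟩ : ∃ c, b = 1 + c := ⟨b - 1, by ring⟩
    rw [h]
    have hc : 0 ≤ c := by linarith
    have e1 : R ≤ R ^ 4 := le_self_pow₀ hR (by norm_num)
    have e2 : R ^ 2 ≤ R ^ 4 := pow_le_pow_right₀ hR (by norm_num)
    have e3 : R ^ 3 ≤ R ^ 4 := pow_le_pow_right₀ hR (by norm_num)
    nlinarith [mul_le_mul_of_nonneg_right e1 hc,
      mul_le_mul_of_nonneg_right e2 (pow_nonneg hc 2),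
      mul_le_mul_of_nonneg_right e3 (pow_nonneg hc 3)]
  linarith

theorem le_growth_of_sq_le {R : ℝ} (hR : 0 ≤ R) {x : EuclideanSpace ℝ (Fin n)}
    (hx : R ^ 2 ≤ ‖x‖) : R - 1 ≤ growth x := by
  unfold growth
  have h1 : ‖x‖ ≤ √(1 + ‖x‖ ^ 2) := Real.le_sqrt_of_sq_le (by linarith)
  have := Real.sqrt_le_sqrt (hx.trans h1)
  rw [Real.sqrt_sq hR] at this
  linarith

theorem growth_le_norm (x : EuclideanSpace ℝ (Fin n)) : growth x ≤ ‖x‖ := by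
  have := growth_add_le 0 x
  simpa [growth] using this

/-- Combines `1 + |x+y|² ≤ (1 + |x|²)(1 + |y|)²` with Bernoulli's inequality. The factor `bump x` on
the error lets the drift cost be absorbed by a linear decay of the coefficient of the bump. -/
theorem bump_add_ge (x y : EuclideanSpace ℝ (Fin n)) :
    bump x - 2 * (n + 1) * bump x * ‖y‖ ≤ bump (x + y) := by
  have hb := bump_pos x
  by_cases hy : 1 < ‖y‖
  · have := bump_pos (x + y)
    have : (1 : ℝ) ≤ 2 * (n + 1) * ‖y‖ := by
      have : (0 : ℝ) ≤ n := by positivity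
      nlinarith
    nlinarith
  push Not at hy
  have hp : (1 : ℝ) + ‖x + y‖ ^ 2 ≤ (1 + ‖x‖ ^ 2) * (1 + ‖y‖) ^ 2 := by
    have h3 : ‖x + y‖ ^ 2 ≤ (‖x‖ + ‖y‖) ^ 2 := by gcongr; exact norm_add_le x y
    nlinarith [norm_nonneg y, norm_nonneg x, mul_nonneg (norm_nonneg y) (sq_nonneg (‖x‖ - 1)),
      mul_nonneg (norm_nonneg y) (sq_nonneg ‖x‖), sq_nonneg (‖x‖ * ‖y‖)]
  have h1 : (1 + ‖x‖ ^ 2)⁻¹ * (1 - ‖y‖) ^ 2 ≤ (1 + ‖x + y‖ ^ 2)⁻¹ := by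
    have h2 : ((1 + ‖x‖ ^ 2) * (1 + ‖y‖) ^ 2)⁻¹ ≤ (1 + ‖x + y‖ ^ 2)⁻¹ := by gcongr
    refine le_trans ?_ h2
    rw [mul_inv]
    gcongr
    rw [← inv_pow]
    have hy0 := norm_nonneg y
    have h3 : 1 - ‖y‖ ≤ (1 + ‖y‖)⁻¹ := by
      rw [← one_div, le_div_iff₀ (by positivity)]
      nlinarith
    have h4 : 0 ≤ 1 - ‖y‖ := by linarith
    gcongr
  have h4 : bump x * ((1 - ‖y‖) ^ 2) ^ (n + 1) ≤ bump (x + y) := by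
    unfold bump
    rw [← mul_pow]
    gcongr
  have h5 : 1 - 2 * (n + 1) * ‖y‖ ≤ ((1 - ‖y‖) ^ 2) ^ (n + 1) := by
    rw [← pow_mul]
    have := one_add_mul_le_pow (a := -‖y‖) (by linarith) (2 * (n + 1))
    push_cast at this
    rw [← sub_eq_add_neg] at this
    linarith
  nlinarith [mul_le_mul_of_nonneg_left h5 hb.le]

/-- Convexity of `s ↦ s^{-(n+1)}` and the parallelogram law bound the average of the two translates
below by the value at `1 + |x|² + |y|²`; Bernoulli's inequality then produces an error proportional
to `bump x`. -/
theorem le_secondDiff_bump (x y : EuclideanSpace ℝ (Fin n)) :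
    -(2 * (n + 1) * bump x * min (√‖y‖) (‖y‖ ^ 2)) ≤ secondDiff bump x y := by
  have hp := parallelogram_law_with_norm ℝ x y
  have hb := bump_pos x
  set p := 1 + ‖x‖ ^ 2 with hpdef
  set q := ‖y‖ ^ 2 with hq
  have hp1 : 1 ≤ p := by have := sq_nonneg ‖x‖; linarith
  have hq0 : 0 ≤ q := by positivity
  set X := (1 + ‖x + y‖ ^ 2)⁻¹ with hX
  set Y := (1 + ‖x - y‖ ^ 2)⁻¹ with hY
  have hX0 : 0 < X := by positivity
  have hY0 : 0 < Y := by positivity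
  have h1 : 2 * (p + q)⁻¹ ≤ X + Y := by
    have e : p + q = (X⁻¹ + Y⁻¹) / 2 := by rw [hX, hY, inv_inv, inv_inv]; linarith
    rw [e]
    have : (X⁻¹ + Y⁻¹) / 2 = (X + Y) / (2 * X * Y) := by field_simp; ring
    rw [this, inv_div]
    rw [← mul_div_assoc, div_le_iff₀ (by positivity)]
    nlinarith [sq_nonneg (X - Y)]
  have h2 : 2 * (p + q)⁻¹ ^ (n + 1) ≤ X ^ (n + 1) + Y ^ (n + 1) := by
    have e := add_pow_le hX0.le hY0.le (n + 1)
    have e' : (2 * (p + q)⁻¹) ^ (n + 1) ≤ (X + Y) ^ (n + 1) := by gcongr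
    rw [mul_pow] at e'
    simp only [Nat.add_sub_cancel] at e
    have e2 : (0 : ℝ) < 2 ^ n := by positivity
    rw [pow_succ (2 : ℝ)] at e'
    have : (2 : ℝ) ^ n * (2 * (p + q)⁻¹ ^ (n + 1)) ≤ 2 ^ n * (X ^ (n + 1) + Y ^ (n + 1)) := by
      linarith
    exact le_of_mul_le_mul_left this e2
  have h3 : bump x * (1 - (n + 1) * (q / (p + q))) ≤ (p + q)⁻¹ ^ (n + 1) := by
    have e : (p + q)⁻¹ ^ (n + 1) = bump x * (1 + -(q / (p + q))) ^ (n + 1) := by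
      unfold bump
      rw [← mul_pow, ← hpdef]
      congr 1
      field_simp
      ring
    rw [e]
    gcongr
    have := one_add_mul_le_pow (a := -(q / (p + q))) (by
      have : q / (p + q) ≤ 1 := by rw [div_le_one (by linarith)]; linarith
      linarith) (n + 1)
    push_cast at this
    linarith
  have h4 : q / (p + q) ≤ min (√‖y‖) q := by
    have e1 : q / (p + q) ≤ 1 := by rw [div_le_one (by linarith)]; linarith
    have e2 : q / (p + q) ≤ q := div_le_self hq0 (by linarith)
    refine le_min ?_ e2
    by_cases h : 1 ≤ ‖y‖
    · exact e1.trans (Real.one_le_sqrt.2 h)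
    · push Not at h
      refine e2.trans (Real.le_sqrt_of_sq_le ?_)
      rw [hq, ← pow_mul]
      exact pow_le_of_le_one (norm_nonneg y) h.le (by norm_num)
  have h5 : (n + 1) * bump x * (q / (p + q)) ≤ (n + 1) * bump x * min (√‖y‖) q := by
    gcongr
  have e : secondDiff bump x y = X ^ (n + 1) + Y ^ (n + 1) - 2 * bump x := rfl
  rw [e]
  nlinarith

theorem bump_ge_of_norm_le_one {x : EuclideanSpace ℝ (Fin n)} (hx : ‖x‖ ≤ 1) :
    (2 : ℝ)⁻¹ ^ (n + 1) ≤ bump x := by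
  unfold bump
  gcongr
  nlinarith [norm_nonneg x]

/-- The bump decays faster than the kernel `|y|^{-(n+1)}`, so the nonlocal term sees mass in the
unit ball from any `x` with weight at least a multiple of `bump x`. -/
theorem bump_mul_norm_pow_le {x y : EuclideanSpace ℝ (Fin n)} (h : ‖x + y‖ ≤ 1) :
    (2 : ℝ)⁻¹ ^ (n + 1) * bump x * ‖y‖ ^ (n + 1) ≤ 1 := by
  unfold bump
  rw [← mul_pow, ← mul_pow]
  refine pow_le_one₀ (by positivity) ?_
  have h1 : ‖y‖ ≤ 1 + ‖x‖ := by
    have := norm_sub_le (x + y) x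
    rw [add_sub_cancel_left] at this
    linarith
  have : ‖y‖ ≤ 2 * (1 + ‖x‖ ^ 2) := by nlinarith [sq_nonneg (‖x‖ - 1)]
  rw [mul_comm, ← mul_inv, ← div_eq_mul_inv, div_le_one (by positivity)]
  exact this

theorem kern_nonneg (y : EuclideanSpace ℝ (Fin n)) : 0 ≤ kern y := by
  unfold kern; positivity

theorem kern_mul (y : EuclideanSpace ℝ (Fin n)) :
    kern y * ‖y‖ ^ (n + 1) = min (√‖y‖) (‖y‖ ^ 2) := by
  unfold kern
  by_cases hy : ‖y‖ = 0
  · simp [hy]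
  · field_simp

theorem integrable_kern (hn : 1 ≤ n) :
    Integrable (kern : EuclideanSpace ℝ (Fin n) → ℝ) := by
  have : Nonempty (Fin n) := ⟨⟨0, hn⟩⟩
  have h := (integrable_fun_norm_addHaar (volume : Measure (EuclideanSpace ℝ (Fin n)))
    (f := fun r : ℝ => min (√r) (r ^ 2) / r ^ (n + 1)))
  refine h.2 ?_
  -- In polar coordinates the Jacobian `r^{n-1}` reduces the kernel to this function, bounded near
  -- `0` and equal to `r^{-3/2}` beyond `1`.
  have hint : IntegrableOn (fun r : ℝ => min (√r) (r ^ 2) / r ^ 2) (Ioi 0) := by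
    have hmeas : Measurable (fun r : ℝ => min (√r) (r ^ 2) / r ^ 2) := by fun_prop
    rw [← Ioc_union_Ioi_eq_Ioi (zero_le_one' ℝ)]
    refine IntegrableOn.union ?_ ?_
    · refine Measure.integrableOn_of_bounded (M := 1) (by simp) hmeas.aestronglyMeasurable ?_
      refine (ae_restrict_mem measurableSet_Ioc).mono fun r hr => ?_
      have : 0 < r := hr.1
      rw [Real.norm_of_nonneg (by positivity), div_le_one (by positivity)]
      exact min_le_right _ _
    · have h2 : IntegrableOn (fun r : ℝ => r ^ (-(3 / 2) : ℝ)) (Ioi 1) :=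
        integrableOn_Ioi_rpow_of_lt (by norm_num) one_pos
      refine Integrable.mono' h2 hmeas.aestronglyMeasurable ?_
      refine (ae_restrict_mem measurableSet_Ioi).mono fun r hr => ?_
      have hr0 : (0 : ℝ) < r := lt_trans one_pos hr
      rw [Real.norm_of_nonneg (by positivity), div_le_iff₀ (by positivity)]
      refine (min_le_left _ _).trans_eq ?_
      rw [Real.sqrt_eq_rpow, ← Real.rpow_natCast, ← Real.rpow_add hr0]
      norm_num
  refine hint.congr_fun (fun r hr => ?_) measurableSet_Ioi
  have hr0 : (0 : ℝ) < r := hr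
  simp only [finrank_euclideanSpace, Fintype.card_fin, smul_eq_mul]
  obtain ⟨k, rfl⟩ : ∃ k, n = k + 1 := ⟨n - 1, by omega⟩
  simp only [Nat.add_sub_cancel]
  field_simp
  ring

end Barriers

/-! ### From the viscosity definition to the touching inequality. -/

section Touching

variable {n : ℕ}

theorem exists_secondDiff_le_sq {f : EuclideanSpace ℝ (Fin n) → ℝ} (hf : ContDiff ℝ 2 f)
    (x : EuclideanSpace ℝ (Fin n)) :
    ∃ C : ℝ, ∃ r > 0, ∀ y : EuclideanSpace ℝ (Fin n), ‖y‖ < r →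
      |secondDiff f x y| ≤ C * ‖y‖ ^ 2 := by
  have hf' : ContDiff ℝ 1 (fderiv ℝ f) := hf.fderiv_right (by norm_num)
  obtain ⟨K, s, hs, hK⟩ := hf'.contDiffAt.exists_lipschitzOnWith (x := x)
  obtain ⟨r, hr, hrs⟩ := Metric.mem_nhds_iff.1 hs
  have key : ∀ y : EuclideanSpace ℝ (Fin n), ‖y‖ < r →
      |f (x + y) - f x - fderiv ℝ f x y| ≤ K * ‖y‖ ^ 2 := by
    intro y hy
    have := (convex_closedBall x ‖y‖).norm_image_sub_le_of_norm_fderiv_le' (𝕜 := ℝ) (f := f)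
      (φ := fderiv ℝ f x) (C := K * ‖y‖) (x := x) (y := x + y)
      (fun z _ => (hf.differentiable (by norm_num)) z)
      (fun z hz => by
        rw [mem_closedBall_iff_norm] at hz
        refine (hK.norm_sub_le (hrs ?_) (hrs (Metric.mem_ball_self hr))).trans ?_
        · rw [mem_ball_iff_norm]; linarith
        · gcongr)
      (by simp) (by simp)
    rw [add_sub_cancel_left] at this
    rw [← Real.norm_eq_abs]
    refine this.trans_eq (by ring)
  refine ⟨2 * K, r, hr, fun y hy => ?_⟩
  have h1 := abs_le.1 (key y hy)
  have h2 := key (-y) (by rwa [norm_neg])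
  rw [norm_neg, map_neg, ← sub_eq_add_neg] at h2
  have h2 := abs_le.1 h2
  unfold secondDiff
  rw [abs_le]
  constructor <;> linarith [h1.1, h1.2, h2.1, h2.2]

/-- The integrand is dominated by a multiple of `kern`: near the origin by the quadratic bound,
elsewhere because `w` is bounded. Integrability must be known, since a Bochner integral that
diverges would be `0` and carry no information. -/
theorem integrable_pucci {l L : ℝ} (hl : 0 ≤ l) (hlL : l ≤ L) (hn : 1 ≤ n)
    {w : EuclideanSpace ℝ (Fin n) → ℝ} (hw : Measurable w) {K : ℝ} (hK : ∀ y, |w y| ≤ K)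
    {x : EuclideanSpace ℝ (Fin n)} {C r : ℝ} (hr : 0 < r)
    (hC : ∀ y : EuclideanSpace ℝ (Fin n), ‖y‖ < r → |secondDiff w x y| ≤ C * ‖y‖ ^ 2) :
    Integrable (fun y : EuclideanSpace ℝ (Fin n) =>
      (L * max (secondDiff w x y) 0 - l * max (-secondDiff w x y) 0) / ‖y‖ ^ (n + 1)) := by
  have hδ : Measurable (fun y => secondDiff w x y) := by
    unfold secondDiff
    fun_prop
  set r₁ := min r 1 with hr₁
  have hr₁0 : 0 < r₁ := lt_min hr one_pos
  set μ := min (√r₁) (r₁ ^ 2) with hμ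
  have hμ0 : 0 < μ := by positivity
  have hK0 : 0 ≤ K := (abs_nonneg _).trans (hK 0)
  have hbound : ∀ y : EuclideanSpace ℝ (Fin n),
      |secondDiff w x y| ≤ (|C| + 4 * K / μ) * min (√‖y‖) (‖y‖ ^ 2) := by
    intro y
    by_cases hy : ‖y‖ < r₁
    · have hy1 : ‖y‖ ≤ 1 := (hy.trans_le (min_le_right _ _)).le
      have hmin : min (√‖y‖) (‖y‖ ^ 2) = ‖y‖ ^ 2 := by
        refine min_eq_right (Real.le_sqrt_of_sq_le ?_)
        rw [← pow_mul]
        exact pow_le_of_le_one (norm_nonneg y) hy1 (by norm_num)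
      rw [hmin]
      refine (hC y (hy.trans_le (min_le_left _ _))).trans ?_
      gcongr
      have := le_abs_self C
      have : 0 ≤ 4 * K / μ := by positivity
      linarith
    · push Not at hy
      have h1 : μ ≤ min (√‖y‖) (‖y‖ ^ 2) := by
        rw [hμ]; gcongr
      have h2 : |secondDiff w x y| ≤ 4 * K := by
        have e1 := abs_le.1 (hK (x + y))
        have e2 := abs_le.1 (hK (x - y))
        have e3 := abs_le.1 (hK x)
        unfold secondDiff
        rw [abs_le]
        constructor <;> linarith [e1.1, e1.2, e2.1, e2.2, e3.1, e3.2]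
      refine h2.trans ?_
      calc 4 * K = 4 * K / μ * μ := by field_simp
        _ ≤ (|C| + 4 * K / μ) * min (√‖y‖) (‖y‖ ^ 2) := by
            gcongr
            have := abs_nonneg C
            linarith
  refine Integrable.mono' ((integrable_kern hn).const_mul (L * (|C| + 4 * K / μ))) ?_ ?_
  · refine Measurable.aestronglyMeasurable ?_
    fun_prop
  · refine Filter.Eventually.of_forall fun y => ?_
    have hL : 0 ≤ L := hl.trans hlL
    rw [norm_div, norm_pow, norm_norm]
    unfold kern
    rw [← mul_div_assoc, mul_assoc]
    gcongr
    have e : ‖L * max (secondDiff w x y) 0 - l * max (-secondDiff w x y) 0‖ ≤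
        L * |secondDiff w x y| := by
      rw [Real.norm_eq_abs]
      rcases le_total 0 (secondDiff w x y) with h | h
      · rw [max_eq_left h, max_eq_right (by linarith), mul_zero, sub_zero, abs_mul,
          abs_of_nonneg hL]
      · rw [max_eq_right h, max_eq_left (by linarith), mul_zero, zero_sub, abs_neg, abs_mul,
          abs_of_nonneg hl, abs_neg]
        gcongr
    exact e.trans (by gcongr; exact hbound y)

/-- A one-sided bound is enough: the slope is tested in the direction of the gradient itself. -/
theorem norm_gradient_le {f : EuclideanSpace ℝ (Fin n) → ℝ} {x : EuclideanSpace ℝ (Fin n)}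
    (hf : DifferentiableAt ℝ f x) {D : ℝ} (hD0 : 0 ≤ D) (hD : ∀ y, f (x + y) ≤ f x + D * ‖y‖) :
    ‖gradient f x‖ ≤ D := by
  set v := gradient f x with hv
  have h1 : HasDerivAt (fun s : ℝ => x + s • v) v 0 := by
    simpa using ((hasDerivAt_id (0 : ℝ)).smul_const v).const_add x
  have h2 : HasFDerivAt f (fderiv ℝ f x) (x + (0 : ℝ) • v) := by
    simpa using hf.hasFDerivAt
  have h3 := (h2.comp_hasDerivAt 0 h1).tendsto_slope_zero_right
  have h4 : fderiv ℝ f x v = ‖v‖ ^ 2 := by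
    have : fderiv ℝ f x v = inner ℝ v v := by
      rw [← InnerProductSpace.toDual_apply_apply, hv]
      unfold gradient
      rw [LinearIsometryEquiv.apply_symm_apply]
    rw [this, real_inner_self_eq_norm_sq]
  rw [h4] at h3
  have h5 : ‖v‖ ^ 2 ≤ D * ‖v‖ := by
    refine le_of_tendsto h3 ?_
    filter_upwards [self_mem_nhdsWithin] with s hs
    have hs0 : (0 : ℝ) < s := hs
    have := hD (s • v)
    rw [norm_smul, Real.norm_of_nonneg hs0.le] at this
    simp only [Function.comp_apply, zero_add, zero_smul, add_zero, smul_eq_mul]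
    rw [inv_mul_le_iff₀ hs0]
    linarith
  by_contra! hcon
  nlinarith

/-- The nonlocal differential inequality obtained when `u(·,t₀)` is touched from above at `x₀` by
a smooth function `f` on the whole space, `h` being the slope in time of the test function. -/
def TouchBound (A l L T : ℝ) (u : EuclideanSpace ℝ (Fin n) → ℝ → ℝ) : Prop :=
  ∀ (x₀ : EuclideanSpace ℝ (Fin n)) (t₀ r₀ D : ℝ) (f h a k : EuclideanSpace ℝ (Fin n) → ℝ),
    0 < r₀ → r₀ ≤ t₀ → t₀ ≤ T → ContDiff ℝ 2 f → ContDiff ℝ 2 h →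
    f x₀ = u x₀ t₀ → (∀ y, u y t₀ ≤ f y) →
    (∀ y s, y ∈ Metric.ball x₀ r₀ → t₀ - r₀ < s → s ≤ t₀ → u y s ≤ f y + (s - t₀) * h y) →
    0 ≤ D → (∀ y, f (x₀ + y) ≤ f x₀ + D * ‖y‖) →
    Integrable a → Integrable k → (∀ y, 0 ≤ a y) → (∀ y, 0 ≤ k y) →
    (∀ y, secondDiff f x₀ y ≤ a y * ‖y‖ ^ (n + 1)) →
    (∀ y, k y * ‖y‖ ^ (n + 1) ≤ f (x₀ + y) - u (x₀ + y) t₀) →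
    h x₀ ≤ A * D + L / 2 * (∫ y, a y) - l * ∫ y, k y

/-- The time derivative, the gradient and the nonlocal term all scale by the same factor, so `A`,
`l` and `L` do not change. The test data are carried back to the original variables. -/
theorem TouchBound.affine {A l L T : ℝ} {u : EuclideanSpace ℝ (Fin n) → ℝ → ℝ}
    (hu : TouchBound A l L T u) {ρ κ c T' t₁ : ℝ} (hρ : 0 < ρ) (hκ : 0 < κ) (ht₁ : 0 ≤ t₁)
    (hT : t₁ + ρ * T' ≤ T) (x₁ : EuclideanSpace ℝ (Fin n)) :
    TouchBound A l L T' (fun x t => c + κ * u (x₁ + ρ • x) (t₁ + ρ * t)) := by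
  intro x₀ t₀ r₀ D f h a k hr₀ hrt htT hf hh hfx hfu hloc hD hfD ha hk ha0 hk0 hfa hfk
  have hρ' := hρ.ne'
  have hκ' := hκ.ne'
  have hz : ∀ y, ρ⁻¹ • (x₁ + ρ • x₀ + y - x₁) = x₀ + ρ⁻¹ • y := by
    intro y
    rw [show x₁ + ρ • x₀ + y - x₁ = ρ • x₀ + y by abel, smul_add, smul_smul,
      inv_mul_cancel₀ hρ', one_smul]
  have hz' : ∀ y, ρ⁻¹ • (x₁ + ρ • x₀ - y - x₁) = x₀ - ρ⁻¹ • y := by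
    intro y
    have := hz (-y)
    rwa [smul_neg, ← sub_eq_add_neg, ← sub_eq_add_neg] at this
  have hz0 : ρ⁻¹ • (x₁ + ρ • x₀ - x₁) = x₀ := by
    rw [add_sub_cancel_left, smul_smul, inv_mul_cancel₀ hρ', one_smul]
  have hw : ∀ y, x₁ + ρ • (ρ⁻¹ • (y - x₁)) = y := by
    intro y
    rw [smul_smul, mul_inv_cancel₀ hρ', one_smul]; abel
  have hw' : ∀ y, x₁ + ρ • (x₀ + ρ⁻¹ • y) = x₁ + ρ • x₀ + y := by
    intro y
    rw [smul_add, smul_smul, mul_inv_cancel₀ hρ', one_smul, add_assoc]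
  have hnorm : ∀ y : EuclideanSpace ℝ (Fin n), ‖ρ⁻¹ • y‖ = ρ⁻¹ * ‖y‖ := by
    intro y
    rw [norm_smul, Real.norm_of_nonneg (by positivity)]
  have hpow : ∀ y : EuclideanSpace ℝ (Fin n),
      ‖ρ⁻¹ • y‖ ^ (n + 1) = (ρ ^ (n + 1))⁻¹ * ‖y‖ ^ (n + 1) := by
    intro y
    rw [hnorm, mul_pow, inv_pow]
  have hcont : ContDiff ℝ 2 (fun z : EuclideanSpace ℝ (Fin n) => ρ⁻¹ • (z - x₁)) := by fun_prop
  have hmain := hu (x₁ + ρ • x₀) (t₁ + ρ * t₀) (ρ * r₀) (D / (κ * ρ))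
    (fun z => (f (ρ⁻¹ • (z - x₁)) - c) / κ) (fun z => h (ρ⁻¹ • (z - x₁)) / (κ * ρ))
    (fun y => a (ρ⁻¹ • y) * ((ρ ^ (n + 1))⁻¹ / κ)) (fun y => k (ρ⁻¹ • y) * ((ρ ^ (n + 1))⁻¹ / κ))
    (by positivity) (by nlinarith) (by nlinarith)
    (((hf.comp hcont).sub contDiff_const).div_const _) ((hh.comp hcont).div_const _)
    (by
      rw [hz0, hfx]
      field_simp
      ring)
    (fun y => by
      have := hfu (ρ⁻¹ • (y - x₁))
      dsimp only at this
      rw [hw] at this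
      rw [le_div_iff₀ hκ]
      linarith)
    (fun y s hy hs hs' => by
      have := hloc (ρ⁻¹ • (y - x₁)) ((s - t₁) / ρ)
        (by
          rw [mem_ball_iff_norm] at hy ⊢
          have e : ρ⁻¹ • (y - x₁) - x₀ = ρ⁻¹ • (y - (x₁ + ρ • x₀)) := by
            rw [← sub_sub, smul_sub ρ⁻¹ (y - x₁), smul_smul, inv_mul_cancel₀ hρ', one_smul]
          rw [e, hnorm, inv_mul_lt_iff₀ hρ]
          exact hy)
        (by rw [lt_div_iff₀ hρ]; nlinarith)
        (by rw [div_le_iff₀ hρ]; nlinarith)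
      dsimp only at this
      rw [hw, show t₁ + ρ * ((s - t₁) / ρ) = s by field_simp; ring] at this
      have e : (f (ρ⁻¹ • (y - x₁)) - c) / κ +
          (s - (t₁ + ρ * t₀)) * (h (ρ⁻¹ • (y - x₁)) / (κ * ρ)) =
          (f (ρ⁻¹ • (y - x₁)) + ((s - t₁) / ρ - t₀) * h (ρ⁻¹ • (y - x₁)) - c) / κ := by
        field_simp
        ring
      rw [e, le_div_iff₀ hκ]
      linarith)
    (by positivity)
    (fun y => by
      have := hfD (ρ⁻¹ • y)
      rw [hnorm] at this
      rw [hz, hz0]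
      have e : (f x₀ - c) / κ + D / (κ * ρ) * ‖y‖ = (f x₀ + D * (ρ⁻¹ * ‖y‖) - c) / κ := by
        field_simp
        ring
      rw [e]
      gcongr)
    ((ha.comp_smul (inv_ne_zero hρ')).mul_const _) ((hk.comp_smul (inv_ne_zero hρ')).mul_const _)
    (fun y => mul_nonneg (ha0 _) (by positivity)) (fun y => mul_nonneg (hk0 _) (by positivity))
    (fun y => by
      have := hfa (ρ⁻¹ • y)
      rw [hpow] at this
      unfold secondDiff at this ⊢
      dsimp only
      rw [hz, hz', hz0]
      have e : a (ρ⁻¹ • y) * ((ρ ^ (n + 1))⁻¹ / κ) * ‖y‖ ^ (n + 1) =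
        (a (ρ⁻¹ • y) * ((ρ ^ (n + 1))⁻¹ * ‖y‖ ^ (n + 1))) / κ := by ring
      rw [e, le_div_iff₀ hκ]
      refine le_trans (le_of_eq ?_) this
      field_simp
      ring)
    (fun y => by
      have := hfk (ρ⁻¹ • y)
      dsimp only at this ⊢
      rw [hpow, hw'] at this
      rw [hz]
      have e : k (ρ⁻¹ • y) * ((ρ ^ (n + 1))⁻¹ / κ) * ‖y‖ ^ (n + 1) =
        (k (ρ⁻¹ • y) * ((ρ ^ (n + 1))⁻¹ * ‖y‖ ^ (n + 1))) / κ := by ring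
      rw [e, div_le_iff₀ hκ]
      refine this.trans (le_of_eq ?_)
      field_simp
      ring)
  -- The weights carry `ρ^{-(n+1)}/κ` and the change of variables returns `ρ^n`, so both integrals
  -- acquire the factor `1/(κρ)` already present in the slopes `h` and `D`.
  rw [hz0, integral_mul_const, integral_mul_const,
    Measure.integral_comp_inv_smul_of_nonneg _ _ hρ.le,
    Measure.integral_comp_inv_smul_of_nonneg _ _ hρ.le] at hmain
  simp only [finrank_euclideanSpace, Fintype.card_fin, smul_eq_mul] at hmain
  rw [div_le_iff₀ (by positivity)] at hmain
  refine hmain.trans (le_of_eq ?_)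
  field_simp
  ring

theorem patch_of_mem_ball {φ u : EuclideanSpace ℝ (Fin n) → ℝ → ℝ}
    {x y : EuclideanSpace ℝ (Fin n)} {t r s : ℝ} (hy : y ∈ Metric.ball x r)
    (hs : s ∈ Ioo (t - r) (t + r)) : patch φ u x t r y s = φ y s := by
  unfold patch
  rw [if_pos ⟨hy, hs⟩]

theorem patch_of_notMem_ball {φ u : EuclideanSpace ℝ (Fin n) → ℝ → ℝ}
    {x y : EuclideanSpace ℝ (Fin n)} {t r s : ℝ} (hy : y ∉ Metric.ball x r) :
    patch φ u x t r y s = u y s := by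
  unfold patch
  rw [if_neg fun h => hy h.1]

-- On a small ball the patch is the test function, and outside it is `u`, so the gap `f - u` lowers
-- the second difference there. Since each value of the gap is counted at `y` and `-y`, the factor
-- `1/2` cancels and `l ∫ k` over the exterior of the ball remains; the radius is then sent to zero.
open Classical in
theorem IsViscositySubsolution.touchBound {A l L T : ℝ} (hA : 0 ≤ A) (hl : 0 ≤ l) (hlL : l ≤ L)
    (hn : 1 ≤ n) {u : EuclideanSpace ℝ (Fin n) → ℝ → ℝ}
    (hcont : ContinuousOn (Function.uncurry u) (univ ×ˢ Icc (0 : ℝ) T))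
    (hbdd : ∃ K : ℝ, ∀ x, ∀ t ∈ Icc (0 : ℝ) T, |u x t| ≤ K)
    (hu : IsViscositySubsolution A l L T u) : TouchBound A l L T u := by
  intro x₀ t₀ r₀ D f h a k hr₀ hrt htT hf hh hfx hfu hloc hD hfD ha hk ha0 hk0 hfa hfk
  obtain ⟨K, hK⟩ := hbdd
  have ht₀ : 0 < t₀ := hr₀.trans_le hrt
  have hL : 0 ≤ L := hl.trans hlL
  have hut : Continuous (fun y => u y t₀) := by
    have : ContinuousOn ((Function.uncurry u) ∘ fun y => (y, t₀)) univ :=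
      hcont.comp (by fun_prop) (fun y _ => ⟨mem_univ _, ht₀.le, htT⟩)
    exact continuousOn_univ.1 this
  set φ : EuclideanSpace ℝ (Fin n) → ℝ → ℝ := fun y s => f y + (s - t₀) * h y with hφ
  have hφt : ∀ y, φ y t₀ = f y := fun y => by simp [hφ]
  have hφc : ContDiff ℝ 2 (Function.uncurry φ) := by
    change ContDiff ℝ 2 (fun p : EuclideanSpace ℝ (Fin n) × ℝ => f p.1 + (p.2 - t₀) * h p.1)
    exact (hf.comp contDiff_fst).add ((contDiff_snd.sub contDiff_const).mul (hh.comp contDiff_fst))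
  -- the inequality obtained from a patch of small radius
  have main : ∀ r, 0 < r → r ≤ r₀ →
      h x₀ ≤ A * D + L / 2 * (∫ y, a y) - l * ∫ y in (Metric.ball 0 r)ᶜ, k y := by
    intro r hr hrr
    have htest := hu.test φ hφc x₀ t₀ r ht₀ htT hr (by rw [hφt, hfx])
      (fun y s hy hs hs' _ => hloc y s (Metric.ball_subset_ball hrr hy) (by linarith) hs')
    set w : EuclideanSpace ℝ (Fin n) → ℝ := fun y => patch φ u x₀ t₀ r y t₀ with hwdef
    have htm : t₀ ∈ Ioo (t₀ - r) (t₀ + r) := ⟨by linarith, by linarith⟩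
    have hwin : ∀ y ∈ Metric.ball x₀ r, w y = f y := fun y hy => by
      rw [hwdef]; simp only; rw [patch_of_mem_ball hy htm, hφt]
    have hwout : ∀ y ∉ Metric.ball x₀ r, w y = u y t₀ := fun y hy => patch_of_notMem_ball hy
    have hderiv : deriv (fun s => patch φ u x₀ t₀ r x₀ s) t₀ = h x₀ := by
      have e : (fun s => patch φ u x₀ t₀ r x₀ s) =ᶠ[nhds t₀] fun s => f x₀ + (s - t₀) * h x₀ := by
        filter_upwards [Ioo_mem_nhds htm.1 htm.2] with s hs
        exact patch_of_mem_ball (Metric.mem_ball_self hr) hs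
      rw [e.deriv_eq]
      have : HasDerivAt (fun s : ℝ => f x₀ + (s - t₀) * h x₀) (1 * h x₀) t₀ :=
        (((hasDerivAt_id t₀).sub_const t₀).mul_const (h x₀)).const_add (f x₀)
      rw [this.deriv, one_mul]
    have hgrad : ‖gradient w x₀‖ ≤ D := by
      have e : w =ᶠ[nhds x₀] f := by
        filter_upwards [Metric.ball_mem_nhds x₀ hr] with y hy using hwin y hy
      rw [e.gradient_eq]
      exact norm_gradient_le (hf.differentiable (by norm_num) x₀) hD hfD
    have hwm : Measurable w := by
      have e : w = (Metric.ball x₀ r).piecewise f (fun y => u y t₀) := by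
        ext y
        by_cases hy : y ∈ Metric.ball x₀ r
        · rw [hwin y hy, piecewise_eq_of_mem _ _ _ hy]
        · rw [hwout y hy, piecewise_eq_of_notMem _ _ _ hy]
      rw [e]
      exact Measurable.piecewise Metric.isOpen_ball.measurableSet hf.continuous.measurable
        hut.measurable
    obtain ⟨K', hK'⟩ := (isCompact_closedBall x₀ r).exists_bound_of_continuousOn
      hf.continuous.continuousOn
    have hwb : ∀ y, |w y| ≤ max K K' := by
      intro y
      by_cases hy : y ∈ Metric.ball x₀ r
      · rw [hwin y hy]
        exact (hK' y (Metric.ball_subset_closedBall hy)).trans (le_max_right _ _)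
      · rw [hwout y hy]
        exact (hK y t₀ ⟨ht₀.le, htT⟩).trans (le_max_left _ _)
    have hx₀w : w x₀ = f x₀ := hwin x₀ (Metric.mem_ball_self hr)
    have hwle : ∀ y, w y ≤ f y := by
      intro y
      by_cases hy : y ∈ Metric.ball x₀ r
      · exact (hwin y hy).le
      · rw [hwout y hy]; exact hfu y
    have hwδ : ∀ y, ‖y‖ < r → secondDiff w x₀ y = secondDiff f x₀ y := by
      intro y hy
      unfold secondDiff
      rw [hwin (x₀ + y) (by simpa using hy), hwin (x₀ - y) (by simpa using hy), hx₀w]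
    obtain ⟨C, r₁, hr₁, hC⟩ := exists_secondDiff_le_sq hf x₀
    have hint := integrable_pucci (L := L) hl hlL hn hwm hwb (lt_min hr hr₁) (x := x₀) (C := C)
      (fun y hy => by
        rw [hwδ y (hy.trans_le (min_le_left _ _))]
        exact hC y (hy.trans_le (min_le_right _ _)))
    set k' : EuclideanSpace ℝ (Fin n) → ℝ := (Metric.ball 0 r)ᶜ.indicator k with hk'
    have hk'i : Integrable k' := hk.indicator Metric.isOpen_ball.measurableSet.compl
    have hk'0 : ∀ y, 0 ≤ k' y := fun y => indicator_nonneg (fun y _ => hk0 y) y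
    have hk'w : ∀ y, k' y * ‖y‖ ^ (n + 1) ≤ f (x₀ + y) - w (x₀ + y) := by
      intro y
      by_cases hy : ‖y‖ < r
      · have : k' y = 0 := indicator_of_notMem (by simpa using hy) _
        rw [this, zero_mul]
        linarith [hwle (x₀ + y)]
      · have : k' y = k y := indicator_of_mem (by simpa using hy) _
        rw [this, hwout (x₀ + y) (by simpa using hy)]
        exact hfk y
    have hle : ∀ y, (L * max (secondDiff w x₀ y) 0 - l * max (-secondDiff w x₀ y) 0) /
        ‖y‖ ^ (n + 1) ≤ L * a y - l * (k' y + k' (-y)) := by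
      intro y
      by_cases hy : y = 0
      · subst hy
        have : k' 0 = 0 := indicator_of_notMem (by simpa using hr) _
        simp only [norm_zero, neg_zero, this]
        have := mul_nonneg hL (ha0 0)
        simpa using this
      · have hyn : 0 < ‖y‖ ^ (n + 1) := by
          have := norm_pos_iff.2 hy
          positivity
        rw [div_le_iff₀ hyn]
        have e1 := hk'w y
        have e2 := hk'w (-y)
        rw [norm_neg, ← sub_eq_add_neg] at e2
        have e3 := hfa y
        set q := ‖y‖ ^ (n + 1)
        have e4 : secondDiff w x₀ y ≤ a y * q - (k' y + k' (-y)) * q := by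
          unfold secondDiff at e3 ⊢
          rw [hx₀w]
          linarith
        have ha' : 0 ≤ a y * q := mul_nonneg (ha0 y) hyn.le
        have hk'' : 0 ≤ (k' y + k' (-y)) * q :=
          mul_nonneg (add_nonneg (hk'0 y) (hk'0 (-y))) hyn.le
        rw [show (L * a y - l * (k' y + k' (-y))) * q =
          L * (a y * q) - l * ((k' y + k' (-y)) * q) by ring]
        -- A nonnegative second difference has weight `L`, and weakening it to `l` on the gap loses;
        -- a nonpositive one has weight `l`, and raising it to `L` on `a` loses. Both cases end in
        -- the same bound.
        rcases le_total 0 (secondDiff w x₀ y) with hs | hs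
        · rw [max_eq_left hs, max_eq_right (by linarith)]
          have e5 := mul_le_mul_of_nonneg_left e4 hL
          have e6 := mul_le_mul_of_nonneg_right hlL hk''
          linarith
        · rw [max_eq_right hs, max_eq_left (by linarith)]
          have e5 := mul_le_mul_of_nonneg_left e4 hl
          have e6 := mul_le_mul_of_nonneg_right hlL ha'
          linarith
    have hk'n : Integrable (fun y => k' (-y)) := hk'i.comp_neg
    have hInt := integral_mono hint ((ha.const_mul L).sub ((hk'i.add hk'n).const_mul l)) hle
    have hsum : (∫ y, (L * a y - l * (k' y + k' (-y)))) =
        L * (∫ y, a y) - l * (2 * ∫ y in (Metric.ball 0 r)ᶜ, k y) := by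
      have hs : Integrable (fun y => l * (k' y + k' (-y))) := (hk'i.add hk'n).const_mul l
      rw [integral_sub (ha.const_mul L) hs, integral_const_mul,
        integral_const_mul, integral_add hk'i hk'n, integral_neg_eq_self,
        hk', integral_indicator Metric.isOpen_ball.measurableSet.compl]
      ring
    rw [hderiv] at htest
    have hP : pucciMax l L w x₀ ≤ L / 2 * (∫ y, a y) - l * ∫ y in (Metric.ball 0 r)ᶜ, k y := by
      unfold pucciMax
      have := hInt.trans_eq hsum
      linarith
    have hAD : A * ‖gradient w x₀‖ ≤ A * D := by gcongr
    linarith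
  -- let the radius tend to zero
  have hlim : Filter.Tendsto
      (fun m : ℕ => ∫ y in (Metric.ball (0 : EuclideanSpace ℝ (Fin n)) (r₀ / (m + 1)))ᶜ, k y)
      Filter.atTop (nhds (∫ y, k y)) := by
    have hU : (⋃ m : ℕ, (Metric.ball (0 : EuclideanSpace ℝ (Fin n)) (r₀ / (m + 1)))ᶜ) = {0}ᶜ := by
      rw [← compl_iInter]
      congr 1
      ext y
      simp only [mem_iInter, mem_ball_zero_iff, mem_singleton_iff]
      constructor
      · intro hy
        by_contra hne
        have hpos : 0 < ‖y‖ := norm_pos_iff.2 hne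
        obtain ⟨m, hm⟩ := exists_nat_gt (r₀ / ‖y‖)
        have := hy m
        rw [lt_div_iff₀ (by positivity)] at this
        rw [div_lt_iff₀ hpos] at hm
        nlinarith
      · rintro rfl m
        rw [norm_zero]; positivity
    have := tendsto_setIntegral_of_monotone (μ := volume) (f := k)
      (s := fun m : ℕ => (Metric.ball (0 : EuclideanSpace ℝ (Fin n)) (r₀ / (m + 1)))ᶜ)
      (fun m => Metric.isOpen_ball.measurableSet.compl)
      (fun m m' hmm => compl_subset_compl.2 (Metric.ball_subset_ball (by
        have : (m : ℝ) ≤ m' := by exact_mod_cast hmm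
        gcongr)))
      hk.integrableOn
    rw [hU] at this
    -- Positive dimension makes the origin a null set.
    have hne : Nonempty (Fin n) := ⟨⟨0, hn⟩⟩
    rwa [restrict_compl_singleton] at this
  refine ge_of_tendsto ((hlim.const_mul l).const_sub _) (Filter.Eventually.of_forall fun m => ?_)
  refine main _ (by positivity) (div_le_self hr₀.le ?_)
  have : (0 : ℝ) ≤ m := by positivity
  linarith

theorem pucciMax_neg (l L : ℝ) (w : EuclideanSpace ℝ (Fin n) → ℝ)
    (x : EuclideanSpace ℝ (Fin n)) : pucciMax l L (-w) x = -pucciMin l L w x := by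
  unfold pucciMax pucciMin
  rw [← mul_neg, ← integral_neg]
  congr 2
  ext y
  have : secondDiff (-w) x y = -secondDiff w x y := by
    simp only [secondDiff, Pi.neg_apply]; ring
  rw [this, neg_neg]
  ring

/-- Lets every later estimate be proved by touching from above only. -/
theorem IsViscositySupersolution.neg {A l L T : ℝ} {u : EuclideanSpace ℝ (Fin n) → ℝ → ℝ}
    (hu : IsViscositySupersolution A l L T u) :
    IsViscositySubsolution A l L T (fun x t => -u x t) where
  upperSemicontinuousOn := hu.lowerSemicontinuousOn.neg
  test φ hφ x t r ht htT hr hφx hφu := by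
    have h := hu.test (fun y s => -φ y s) hφ.neg x t r ht htT hr (by rw [hφx, neg_neg])
      (fun y s hy hs hs' hs0 => by linarith [hφu y s hy hs hs' hs0])
    have e : ∀ y s, patch (fun y s => -φ y s) u x t r y s =
        -patch φ (fun x t => -u x t) x t r y s := by
      intro y s
      unfold patch
      split_ifs <;> simp
    simp only [e] at h
    have hg : gradient (fun y => -patch φ (fun x t => -u x t) x t r y t) x =
        -gradient (fun y => patch φ (fun x t => -u x t) x t r y t) x := by
      unfold gradient
      rw [← map_neg, ← fderiv_fun_neg]
    have hm : pucciMin l L (fun y => -patch φ (fun x t => -u x t) x t r y t) x =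
        -pucciMax l L (fun y => patch φ (fun x t => -u x t) x t r y t) x := by
      have := pucciMax_neg l L (fun y => -patch φ (fun x t => -u x t) x t r y t) x
      rw [show -(fun y => -patch φ (fun x t => -u x t) x t r y t) =
        fun y => patch φ (fun x t => -u x t) x t r y t from by ext; simp] at this
      rw [this, neg_neg]
    have hd : deriv (fun s => -patch φ (fun x t => -u x t) x t r x s) t =
        -deriv (fun s => patch φ (fun x t => -u x t) x t r x s) t := deriv.fun_neg
    rw [hg, hm, hd, norm_neg] at h
    linarith

end Touching

/-! ### Comparison with the barrier and the maximum principle. -/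

/-- The speed at which the growth barrier has to be lifted. -/
noncomputable def liftRate (n : ℕ) (A L : ℝ) : ℝ :=
  A + L * (∫ y : EuclideanSpace ℝ (Fin n), kern y) + 1

/-- The weight with which mass in the unit ball improves the bump. -/
noncomputable def gainRate (n : ℕ) (l : ℝ) : ℝ := l * (2 : ℝ)⁻¹ ^ (n + 1)

/-- The rate at which the bump decays. -/
noncomputable def decayRate (n : ℕ) (A l L : ℝ) : ℝ :=
  2 * (n + 1) * A + L * (n + 1) * (∫ y : EuclideanSpace ℝ (Fin n), kern y) +
    gainRate n l * volume.real (Metric.closedBall (0 : EuclideanSpace ℝ (Fin n)) 1)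

section Barrier

variable {n : ℕ}

theorem continuous_slice {T : ℝ} {v : EuclideanSpace ℝ (Fin n) → ℝ → ℝ}
    (hcont : ContinuousOn (Function.uncurry v) (univ ×ˢ Icc (0 : ℝ) T)) {t : ℝ}
    (ht : t ∈ Icc (0 : ℝ) T) : Continuous (fun y => v y t) := by
  have : ContinuousOn ((Function.uncurry v) ∘ fun y => (y, t)) univ :=
    hcont.comp (by fun_prop) (fun y _ => ⟨mem_univ _, ht⟩)
  exact continuousOn_univ.1 this

theorem integral_kern_nonneg : 0 ≤ ∫ y : EuclideanSpace ℝ (Fin n), kern y :=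
  integral_nonneg kern_nonneg

theorem liftRate_pos {A L : ℝ} (hA : 0 ≤ A) (hL : 0 ≤ L) : 0 < liftRate n A L := by
  have := mul_nonneg hL (integral_kern_nonneg (n := n))
  unfold liftRate; linarith

/-- Comparison with the barrier `M + ε growth + ε C t - m(t) bump`. -/
theorem TouchBound.le_barrier {A l L T : ℝ} (hn : 1 ≤ n) (hA : 0 ≤ A) (hl : 0 ≤ l) (hL : 0 ≤ L)
    {v : EuclideanSpace ℝ (Fin n) → ℝ → ℝ} (hv : TouchBound A l L T v)
    (hcont : ContinuousOn (Function.uncurry v) (univ ×ˢ Icc (0 : ℝ) T))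
    (hbdd : ∃ K : ℝ, ∀ x, ∀ t ∈ Icc (0 : ℝ) T, |v x t| ≤ K)
    {M ε : ℝ} (hε : 0 < ε) {m m' : ℝ → ℝ} (hm : ∀ t, HasDerivAt m (m' t) t)
    (hm0 : m 0 = 0) (hmnn : ∀ t ∈ Icc (0 : ℝ) T, 0 ≤ m t)
    (hode : ∀ t ∈ Ioc (0 : ℝ) T, m' t + decayRate n A l L * m t ≤
      max 0 (gainRate n l * ∫ z in Metric.closedBall (0 : EuclideanSpace ℝ (Fin n)) 1,
        (M + ε * growth z - v z t)))
    (hinit : ∀ x, v x 0 ≤ M + ε * growth x) :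
    ∀ x, ∀ t ∈ Icc (0 : ℝ) T,
      v x t ≤ M + ε * growth x + ε * liftRate n A L * t - m t * bump x := by
  by_contra! hcon
  obtain ⟨x₁, t₁, ht₁, hx₁⟩ := hcon
  obtain ⟨K, hK⟩ := hbdd
  have hmc : Continuous m := continuous_iff_continuousAt.2 fun t => (hm t).continuousAt
  have hC0 := liftRate_pos (n := n) hA hL
  set C₀ := liftRate n A L with hC₀
  set ψ : EuclideanSpace ℝ (Fin n) × ℝ → ℝ := fun p =>
    Function.uncurry v p - (M + ε * growth p.1 + ε * C₀ * p.2 - m p.2 * bump p.1) with hψ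
  have hgc : Continuous (growth : EuclideanSpace ℝ (Fin n) → ℝ) := contDiff_growth.continuous
  have hbc : Continuous (bump : EuclideanSpace ℝ (Fin n) → ℝ) := contDiff_bump.continuous
  have hψc : ContinuousOn ψ (univ ×ˢ Icc (0 : ℝ) T) :=
    hcont.sub (Continuous.continuousOn (by fun_prop))
  obtain ⟨B, hB⟩ := isCompact_Icc.exists_bound_of_continuousOn (hmc.continuousOn (s := Icc 0 T))
  -- Where `|x| ≥ R²`, the term `ε growth` exceeds `K + B - M`, so the barrier lies above `v` and
  -- the positive maximum may be sought in a compact set.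
  set R := 1 + |K + B - M| / ε with hR
  have hR0 : 0 ≤ R := by positivity
  set Q := max (R ^ 2) ‖x₁‖ with hQ
  obtain ⟨⟨x₀, t₀⟩, ⟨hx₀Q, ht₀T⟩, hmax⟩ := ((isCompact_closedBall (0 : EuclideanSpace ℝ (Fin n))
    Q).prod (isCompact_Icc (a := 0) (b := T))).exists_isMaxOn
    ⟨(x₁, t₁), by simp [hQ], ht₁⟩ (hψc.mono (prod_mono (subset_univ _) le_rfl))
  set σ := ψ (x₀, t₀) with hσdef
  have hσ : 0 < σ := by
    have h1 : ψ (x₁, t₁) ≤ σ := hmax ⟨by simp [hQ], ht₁⟩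
    have h2 : 0 < ψ (x₁, t₁) := by
      simp only [hψ, Function.uncurry_apply_pair]; linarith
    linarith
  have hglob : ∀ y, ∀ s ∈ Icc (0 : ℝ) T,
      v y s ≤ σ + (M + ε * growth y + ε * C₀ * s - m s * bump y) := by
    intro y s hs
    by_cases hy : ‖y‖ ≤ Q
    · have h1 : ψ (y, s) ≤ σ := hmax ⟨by simpa using hy, hs⟩
      simp only [hψ, Function.uncurry_apply_pair] at h1
      linarith
    · push Not at hy
      have h1 := le_growth_of_sq_le hR0 ((le_max_left _ _).trans hy.le)
      have h2 : |K + B - M| ≤ ε * growth y := by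
        rw [hR, add_sub_cancel_left, div_le_iff₀ hε] at h1
        linarith
      have h3 := (abs_le.1 (hK y s hs)).2
      have h4 := (abs_le.1 (hB s hs)).2
      have h5 : m s * bump y ≤ m s := mul_le_of_le_one_right (hmnn s hs) (bump_le_one y)
      have h6 : 0 ≤ ε * C₀ * s := mul_nonneg (by positivity) hs.1
      have h7 := le_abs_self (K + B - M)
      linarith
  have hvx₀ : v x₀ t₀ = σ + (M + ε * growth x₀ + ε * C₀ * t₀ - m t₀ * bump x₀) := by
    simp only [hσdef, hψ, Function.uncurry_apply_pair]; ring
  have ht₀ : 0 < t₀ := by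
    rcases ht₀T.1.eq_or_lt with h | h
    · have := hinit x₀
      have e : t₀ = 0 := h.symm
      rw [e, hm0] at hvx₀
      linarith
    · exact h
  have hm₀ := hmnn t₀ ht₀T
  -- The test function must be affine in time, so `m` is replaced for `s ≤ t₀` by a line below it.
  -- The extra slope `ε/2` is paid by the summand `1` in `liftRate`.
  obtain ⟨δ, hδ, hδm⟩ : ∃ δ > 0, ∀ s, t₀ - δ < s → s ≤ t₀ →
      m t₀ + (m' t₀ + ε / 2) * (s - t₀) ≤ m s := by
    have h1 := ((hasDerivAt_iff_isLittleO.1 (hm t₀)).def (half_pos hε))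
    obtain ⟨δ, hδ, h2⟩ := Metric.eventually_nhds_iff.1 h1
    refine ⟨δ, hδ, fun s hs hs' => ?_⟩
    have h3 := h2 (y := s) (by rw [Real.dist_eq, abs_of_nonpos (by linarith)]; linarith)
    rw [Real.norm_eq_abs, Real.norm_eq_abs, abs_of_nonpos (by linarith : s - t₀ ≤ 0),
      smul_eq_mul] at h3
    have h4 := (abs_le.1 h3).1
    linarith
  set b := bump x₀ with hb
  have hb0 : 0 < b := bump_pos x₀
  have hb1 : b ≤ 1 := bump_le_one x₀
  set S := Metric.closedBall (0 : EuclideanSpace ℝ (Fin n)) 1 with hS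
  set f : EuclideanSpace ℝ (Fin n) → ℝ :=
    fun y => (σ + M + ε * C₀ * t₀) + ε * growth y - m t₀ * bump y with hf
  set g : EuclideanSpace ℝ (Fin n) → ℝ := fun z => f z - v z t₀ with hg
  have hg0 : ∀ z, 0 ≤ g z := fun z => by
    have := hglob z t₀ ht₀T
    simp only [hg, hf]; linarith
  have hfc : ContDiff ℝ 2 f :=
    (contDiff_const.add (contDiff_const.mul contDiff_growth)).sub
      (contDiff_const.mul contDiff_bump)
  have hvc := continuous_slice hcont ht₀T
  have hgi : IntegrableOn g S :=
    (hfc.continuous.sub hvc).continuousOn.integrableOn_compact (isCompact_closedBall _ _)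
  have hgi' : Integrable (S.indicator g) := hgi.integrable_indicator
    (isCompact_closedBall _ _).measurableSet
  set w : ℝ := (2 : ℝ)⁻¹ ^ (n + 1) * b with hw
  have hw0 : 0 ≤ w := by positivity
  have hmain := hv x₀ t₀ (min δ t₀) (ε + 2 * (n + 1) * b * m t₀) f
    (fun y => ε * C₀ - (m' t₀ + ε / 2) * bump y)
    (fun y => (2 * ε + 2 * (n + 1) * b * m t₀) * kern y)
    (fun y => w * S.indicator g (x₀ + y))
    (lt_min hδ ht₀) (min_le_right _ _) ht₀T.2 hfc
    (contDiff_const.sub (contDiff_const.mul contDiff_bump))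
    (by rw [hvx₀]; simp only [hf]; ring)
    (fun y => by have := hg0 y; simp only [hg] at this; linarith)
    (fun y s _ hs hs' => by
      have h1 := hδm s (by linarith [min_le_left δ t₀]) hs'
      have h2 := hglob y s ⟨by linarith [min_le_right δ t₀], hs'.trans ht₀T.2⟩
      have h3 := mul_le_mul_of_nonneg_right h1 (bump_pos y).le
      simp only [hf]
      nlinarith)
    (by positivity)
    (fun y => by
      have h1 := growth_add_le x₀ y
      have h2 := bump_add_ge x₀ y
      have h3 := mul_le_mul_of_nonneg_left h2 hm₀
      have h4 := mul_le_mul_of_nonneg_left h1 hε.le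
      simp only [hf]
      rw [← hb] at h3 ⊢
      linarith)
    ((integrable_kern hn).const_mul _) ((hgi'.comp_add_left x₀).const_mul _)
    (fun y => mul_nonneg (by positivity) (kern_nonneg y))
    (fun y => mul_nonneg hw0 (indicator_nonneg (fun z _ => hg0 z) _))
    (fun y => by
      rw [mul_assoc, kern_mul]
      have h1 := mul_le_mul_of_nonneg_left (secondDiff_growth_le x₀ y) hε.le
      have h2 := mul_le_mul_of_nonneg_left (le_secondDiff_bump x₀ y) hm₀
      have e : secondDiff f x₀ y = ε * secondDiff growth x₀ y - m t₀ * secondDiff bump x₀ y := by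
        simp only [secondDiff, hf]; ring
      rw [e]
      rw [← hb] at h2
      linarith)
    (fun y => by
      change _ ≤ g (x₀ + y)
      by_cases hy : x₀ + y ∈ S
      · rw [indicator_of_mem hy]
        have h1 := bump_mul_norm_pow_le (x := x₀) (y := y) (by simpa [hS] using hy)
        rw [← hb] at h1
        have h2 := mul_le_mul_of_nonneg_right h1 (hg0 (x₀ + y))
        rw [hw]
        linarith
      · rw [indicator_of_notMem hy, mul_zero, zero_mul]
        exact hg0 _)
  rw [integral_const_mul, integral_const_mul, integral_add_left_eq_self (S.indicator g) x₀,
    integral_indicator (isCompact_closedBall _ _).measurableSet] at hmain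
  have hG0 : 0 ≤ ∫ z in S, g z := integral_nonneg hg0
  have hqi : IntegrableOn (fun z => M + ε * growth z - v z t₀) S :=
    Continuous.continuousOn (by fun_prop) |>.integrableOn_compact (isCompact_closedBall _ _)
  -- Compared with the deficit below `M + ε growth`, the gap below the full barrier loses at most `m
  -- t₀` per unit volume; the last summand of `decayRate` compensates for this.
  have hG1 : (∫ z in S, (M + ε * growth z - v z t₀)) - m t₀ * volume.real S ≤ ∫ z in S, g z := by
    have h1 : (∫ z in S, (M + ε * growth z - v z t₀)) - m t₀ * volume.real S =
        ∫ z in S, ((M + ε * growth z - v z t₀) - m t₀) := by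
      rw [integral_sub hqi (integrableOn_const (isCompact_closedBall _ _).measure_lt_top.ne),
        setIntegral_const, smul_eq_mul, mul_comm (m t₀)]
    rw [h1]
    refine integral_mono (hqi.sub (integrableOn_const
      (isCompact_closedBall _ _).measure_lt_top.ne)) hgi fun z => ?_
    have h2 : m t₀ * bump z ≤ m t₀ := mul_le_of_le_one_right hm₀ (bump_le_one z)
    have h3 : 0 ≤ ε * C₀ * t₀ := by positivity
    simp only [hg, hf]
    linarith
  have hV0 : 0 ≤ volume.real S := measureReal_nonneg
  have hode₀ := hode t₀ ⟨ht₀, ht₀T.2⟩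
  have hγ : 0 ≤ gainRate n l := by unfold gainRate; positivity
  have hmax' : max 0 (gainRate n l * ∫ z in S, (M + ε * growth z - v z t₀)) ≤
      gainRate n l * (∫ z in S, g z) + gainRate n l * volume.real S * m t₀ := by
    refine max_le (by positivity) ?_
    have := mul_le_mul_of_nonneg_left hG1 hγ
    linarith
  have hfin := hode₀.trans hmax'
  have hI := integral_kern_nonneg (n := n)
  rw [hC₀] at hmain
  unfold liftRate at hmain
  unfold decayRate at hfin
  rw [← hS] at hfin
  have e : l * (w * ∫ z in S, g z) = b * (gainRate n l * ∫ z in S, g z) := by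
    rw [hw]; unfold gainRate; ring
  rw [e] at hmain
  have hfin' := mul_le_mul_of_nonneg_left hfin hb0.le
  rw [← hb] at hmain
  -- The summand `1` in `liftRate` leaves `ε` on the left and the slope correction costs at most `ε
  -- b/2`; everything else is `b` times a quantity that `hfin` makes nonpositive. This is a
  -- contradiction.
  nlinarith

/-- The barrier without bump, with `ε → 0`. -/
theorem TouchBound.le_of_initial {A l L T : ℝ} (hn : 1 ≤ n) (hA : 0 ≤ A) (hl : 0 ≤ l)
    (hL : 0 ≤ L) {v : EuclideanSpace ℝ (Fin n) → ℝ → ℝ} (hv : TouchBound A l L T v)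
    (hcont : ContinuousOn (Function.uncurry v) (univ ×ˢ Icc (0 : ℝ) T))
    (hbdd : ∃ K : ℝ, ∀ x, ∀ t ∈ Icc (0 : ℝ) T, |v x t| ≤ K) {M : ℝ} (hinit : ∀ x, v x 0 ≤ M)
    (x : EuclideanSpace ℝ (Fin n)) {t : ℝ} (ht : t ∈ Icc (0 : ℝ) T) : v x t ≤ M := by
  have key : ∀ ε > 0, v x t ≤ M + ε * (growth x + liftRate n A L * t) := by
    intro ε hε
    have := hv.le_barrier hn hA hl hL hcont hbdd (M := M) hε (m := fun _ => 0) (m' := fun _ => 0)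
      (fun t => hasDerivAt_const t 0) rfl (fun _ _ => le_rfl) (fun t _ => by simp)
      (fun y => (hinit y).trans (by
        have := mul_nonneg hε.le (growth_nonneg y)
        linarith)) x t ht
    linarith
  have hc : 0 ≤ growth x + liftRate n A L * t :=
    add_nonneg (growth_nonneg x) (mul_nonneg (liftRate_pos hA hL).le ht.1)
  refine le_of_forall_pos_le_add fun η hη => ?_
  have h1 := key (η / (growth x + liftRate n A L * t + 1)) (by positivity)
  refine h1.trans ?_
  gcongr
  rw [div_mul_eq_mul_div, div_le_iff₀ (by positivity)]
  nlinarith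

end Barrier

/-! ### Decay of oscillation and the Hölder exponent. -/

/-- Two-sided solutions on the time interval `[0,1]` which are trapped between
`± (1 + ε growth)`. -/
structure IsTrapped {n : ℕ} (A l L ε : ℝ) (v : EuclideanSpace ℝ (Fin n) → ℝ → ℝ) : Prop where
  continuousOn : ContinuousOn (Function.uncurry v) (univ ×ˢ Icc (0 : ℝ) 1)
  bounded : ∃ K : ℝ, ∀ x, ∀ t ∈ Icc (0 : ℝ) 1, |v x t| ≤ K
  upper : TouchBound A l L 1 v
  lower : TouchBound A l L 1 (fun x t => -v x t)
  abs_le : ∀ x, ∀ t ∈ Icc (0 : ℝ) 1, |v x t| ≤ 1 + ε * growth x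

/-- The mass deficit of `v` below the growth barrier in the unit ball. -/
noncomputable def deficit {n : ℕ} (ε : ℝ) (v : EuclideanSpace ℝ (Fin n) → ℝ → ℝ) (t : ℝ) : ℝ :=
  ∫ z in Metric.closedBall (0 : EuclideanSpace ℝ (Fin n)) 1,
    (1 + ε * growth z - v z (max 0 (min t 1)))

/-- The lower bound for the coefficient of the bump at times in `[1/2, 1]`. -/
noncomputable def bumpGain (n : ℕ) (A l L : ℝ) : ℝ :=
  gainRate n l * Real.exp (-decayRate n A l L) *
    (volume.real (Metric.closedBall (0 : EuclideanSpace ℝ (Fin n)) 1) / 2)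

section Oscillation

variable {n : ℕ} {A l L ε : ℝ} {v : EuclideanSpace ℝ (Fin n) → ℝ → ℝ}

theorem IsTrapped.neg (hv : IsTrapped A l L ε v) : IsTrapped A l L ε (fun x t => -v x t) where
  continuousOn := hv.continuousOn.neg
  bounded := by simpa using hv.bounded
  upper := hv.lower
  lower := by simpa using hv.upper
  abs_le := by simpa using hv.abs_le

theorem clamp_mem (t : ℝ) : max 0 (min t 1) ∈ Icc (0 : ℝ) 1 :=
  ⟨le_max_left _ _, max_le zero_le_one (min_le_right _ _)⟩

theorem clamp_eq {t : ℝ} (ht : t ∈ Icc (0 : ℝ) 1) : max 0 (min t 1) = t := by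
  rw [min_eq_left ht.2, max_eq_right ht.1]

/-- Clamping the time to `[0,1]` makes the deficit continuous on the whole line, so its primitive is
differentiable everywhere, as the barrier lemma demands of `m`. -/
theorem IsTrapped.continuous_clamp (hv : IsTrapped A l L ε v) :
    Continuous (fun p : ℝ × EuclideanSpace ℝ (Fin n) => v p.2 (max 0 (min p.1 1))) := by
  have : ContinuousOn ((Function.uncurry v) ∘ fun p : ℝ × EuclideanSpace ℝ (Fin n) =>
      (p.2, max 0 (min p.1 1))) univ :=
    hv.continuousOn.comp (by fun_prop) (fun p _ => ⟨mem_univ _, clamp_mem _⟩)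
  exact continuousOn_univ.1 this

theorem IsTrapped.continuous_deficit (hv : IsTrapped A l L ε v) : Continuous (deficit ε v) := by
  refine continuous_parametric_integral_of_continuous (μ := volume)
    (f := fun (t : ℝ) (z : EuclideanSpace ℝ (Fin n)) =>
      1 + ε * growth z - v z (max 0 (min t 1))) ?_ (isCompact_closedBall _ _)
  have hg := (contDiff_growth (n := n)).continuous
  exact (continuous_const.add (continuous_const.mul (hg.comp continuous_snd))).sub
    hv.continuous_clamp

theorem IsTrapped.deficit_nonneg (hv : IsTrapped A l L ε v) (t : ℝ) : 0 ≤ deficit ε v t := by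
  refine integral_nonneg fun z => ?_
  have := (_root_.abs_le.1 (hv.abs_le z _ (clamp_mem t))).2
  simp only [Pi.zero_apply]
  linarith

theorem IsTrapped.volume_le_deficit_add (hv : IsTrapped A l L ε v) (hε : 0 ≤ ε) (t : ℝ) :
    2 * volume.real (Metric.closedBall (0 : EuclideanSpace ℝ (Fin n)) 1) ≤
      deficit ε v t + deficit ε (fun x t => -v x t) t := by
  have hK := isCompact_closedBall (0 : EuclideanSpace ℝ (Fin n)) 1
  have hg := (contDiff_growth (n := n)).continuous
  have hvc := continuous_slice hv.continuousOn (clamp_mem t)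
  unfold deficit
  rw [← integral_add (Continuous.continuousOn (by fun_prop) |>.integrableOn_compact hK)
    (Continuous.continuousOn (by fun_prop) |>.integrableOn_compact hK)]
  have : 2 * volume.real (Metric.closedBall (0 : EuclideanSpace ℝ (Fin n)) 1) =
      ∫ _ in Metric.closedBall (0 : EuclideanSpace ℝ (Fin n)) 1, (2 : ℝ) := by
    rw [setIntegral_const, smul_eq_mul, mul_comm]
  rw [this]
  refine integral_mono (integrableOn_const hK.measure_lt_top.ne)
    (Continuous.continuousOn (by fun_prop) |>.integrableOn_compact hK) fun z => ?_
  have := mul_nonneg hε (growth_nonneg z)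
  simp only
  linarith

theorem decayRate_nonneg (hA : 0 ≤ A) (hl : 0 ≤ l) (hL : 0 ≤ L) : 0 ≤ decayRate n A l L := by
  have hI := integral_kern_nonneg (n := n)
  unfold decayRate gainRate
  positivity

/-- If `v` has a substantial deficit at early times, then it is improved by the bump at later
times. -/
theorem IsTrapped.le_sub_bump (hn : 1 ≤ n) (hA : 0 ≤ A) (hl : 0 ≤ l) (hL : 0 ≤ L) (hε : 0 < ε)
    (hv : IsTrapped A l L ε v)
    (hdef : volume.real (Metric.closedBall (0 : EuclideanSpace ℝ (Fin n)) 1) / 2 ≤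
      ∫ t in (0 : ℝ)..(1 / 2), deficit ε v t)
    (x : EuclideanSpace ℝ (Fin n)) {t : ℝ} (ht : t ∈ Icc (1 / 2 : ℝ) 1) :
    v x t ≤ 1 + ε * growth x + ε * liftRate n A L - bumpGain n A l L * bump x := by
  set γ := gainRate n l with hγ
  have hγ0 : 0 ≤ γ := by rw [hγ]; unfold gainRate; positivity
  have hc := hv.continuous_deficit
  have hd := decayRate_nonneg (n := n) hA hl hL
  set d := decayRate n A l L with hddef
  set P : ℝ → ℝ := fun t => ∫ s in (0 : ℝ)..t, deficit ε v s with hP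
  have hP' : ∀ t, HasDerivAt P (deficit ε v t) t := fun t =>
    intervalIntegral.integral_hasDerivAt_right (hc.intervalIntegrable _ _)
      (hc.stronglyMeasurableAtFilter _ _) hc.continuousAt
  have hP0 : ∀ t, 0 ≤ t → 0 ≤ P t := fun t ht =>
    intervalIntegral.integral_nonneg ht fun s _ => hv.deficit_nonneg s
  have hE : ∀ t, HasDerivAt (fun t => Real.exp (-d * t)) (Real.exp (-d * t) * (-d)) t := by
    intro t
    have h1 : HasDerivAt (fun t : ℝ => -d * t) (-d) t := by
      simpa using (hasDerivAt_id t).const_mul (-d)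
    exact h1.exp
  -- This coefficient satisfies `m' + d m = γ e^{-dt} · deficit`, which is at most `γ · deficit`.
  have hm : ∀ t, HasDerivAt (fun t => γ * (Real.exp (-d * t) * P t))
      (γ * (Real.exp (-d * t) * (-d) * P t + Real.exp (-d * t) * deficit ε v t)) t := fun t =>
    ((hE t).mul (hP' t)).const_mul γ
  have ht01 : t ∈ Icc (0 : ℝ) 1 := ⟨by linarith [ht.1], ht.2⟩
  have hmain := hv.upper.le_barrier hn hA hl hL hv.continuousOn hv.bounded (M := 1) hε hm
    (by simp [hP])
    (fun t ht => mul_nonneg hγ0 (mul_nonneg (Real.exp_pos _).le (hP0 t ht.1)))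
    (fun t ht => by
      refine le_trans ?_ (le_max_right _ _)
      have e : deficit ε v t = ∫ z in Metric.closedBall (0 : EuclideanSpace ℝ (Fin n)) 1,
          (1 + ε * growth z - v z t) := by
        unfold deficit
        rw [clamp_eq ⟨ht.1.le, ht.2⟩]
      rw [← e, ← hddef]
      have h1 : Real.exp (-d * t) ≤ 1 := by
        rw [Real.exp_le_one_iff]
        have := mul_nonneg hd ht.1.le
        linarith
      have h2 := mul_le_mul_of_nonneg_right h1 (hv.deficit_nonneg t)
      have h3 := mul_le_mul_of_nonneg_left h2 hγ0
      linarith)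
    (fun x => (_root_.abs_le.1 (hv.abs_le x 0 ⟨le_rfl, zero_le_one⟩)).2) x t ht01
  have h1 : Real.exp (-d) ≤ Real.exp (-d * t) := by
    rw [Real.exp_le_exp]
    nlinarith [ht.2]
  have h2 : volume.real (Metric.closedBall (0 : EuclideanSpace ℝ (Fin n)) 1) / 2 ≤ P t := by
    refine hdef.trans ?_
    rw [hP]
    simp only
    rw [← intervalIntegral.integral_add_adjacent_intervals (hc.intervalIntegrable 0 (1 / 2))
      (hc.intervalIntegrable (1 / 2) t)]
    have := intervalIntegral.integral_nonneg (μ := volume) ht.1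
      fun s _ => hv.deficit_nonneg s
    linarith
  have h3 : bumpGain n A l L ≤ γ * (Real.exp (-d * t) * P t) := by
    unfold bumpGain
    rw [← hγ, ← hddef, mul_assoc]
    gcongr
  have h4 := mul_le_mul_of_nonneg_right h3 (bump_pos x).le
  have h5 : ε * liftRate n A L * t ≤ ε * liftRate n A L :=
    mul_le_of_le_one_right (mul_nonneg hε.le (liftRate_pos hA hL).le) ht.2
  linarith

theorem IsTrapped.deficit_dichotomy (hv : IsTrapped A l L ε v) (hε : 0 ≤ ε) :
    volume.real (Metric.closedBall (0 : EuclideanSpace ℝ (Fin n)) 1) / 2 ≤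
        ∫ t in (0 : ℝ)..(1 / 2), deficit ε v t ∨
      volume.real (Metric.closedBall (0 : EuclideanSpace ℝ (Fin n)) 1) / 2 ≤
        ∫ t in (0 : ℝ)..(1 / 2), deficit ε (fun x t => -v x t) t := by
  have h1 := hv.continuous_deficit
  have h2 := hv.neg.continuous_deficit
  have h3 := intervalIntegral.integral_mono_on (μ := volume) (a := 0) (b := 1 / 2) (by norm_num)
    (continuous_const.intervalIntegrable _ _) ((h1.add h2).intervalIntegrable _ _)
    (fun t _ => hv.volume_le_deficit_add hε t)
  simp only [Pi.add_apply] at h3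
  rw [intervalIntegral.integral_const, intervalIntegral.integral_add (h1.intervalIntegrable _ _)
    (h2.intervalIntegrable _ _), smul_eq_mul] at h3
  by_contra! hcon
  linarith [hcon.1, hcon.2]

/-- The affine map `s ↦ (s + ε/2)/(1 - ε/2)` takes `[-1, 1 - ε]` onto `[-1, 1]`, so a gain of `ε` on
one side restores the original bound. The zoomed times lie in `[1 - R⁻², 1]`, inside `[1/2, 1]`
where the gain is available. -/
theorem IsTrapped.rescale_of_le {R : ℝ} (hA : 0 ≤ A) (hL : 0 ≤ L) (hε : 0 < ε) (hε2 : ε ≤ 1 / 2)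
    (hR : 2 * liftRate n A L + 4 ≤ R)
    (hεm : ε * (liftRate n A L + 1) ≤ bumpGain n A l L * (2 : ℝ)⁻¹ ^ (n + 1))
    (hv : IsTrapped A l L ε v)
    (hle : ∀ x, ∀ t ∈ Icc (1 / 2 : ℝ) 1,
      v x t ≤ 1 + ε * growth x + ε * liftRate n A L - bumpGain n A l L * bump x) :
    IsTrapped A l L ε (fun x t => ε / 2 / (1 - ε / 2) + (1 - ε / 2)⁻¹ *
      v ((R ^ 2)⁻¹ • x) (1 - (R ^ 2)⁻¹ + (R ^ 2)⁻¹ * t)) := by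
  have hC := liftRate_pos (n := n) hA hL
  have hR4 : 4 ≤ R := by linarith
  set C := liftRate n A L
  have hR2 : 16 ≤ R ^ 2 := by nlinarith
  have hρ0 : 0 < (R ^ 2)⁻¹ := by positivity
  have hρ1 : (R ^ 2)⁻¹ ≤ 1 / 2 := by
    rw [inv_le_comm₀ (by positivity) (by norm_num)]; norm_num; linarith
  have hg : ∀ x : EuclideanSpace ℝ (Fin n), growth ((R ^ 2)⁻¹ • x) ≤ growth x / 4 := by
    intro x
    have h1 := growth_inv_sq_smul_le (by linarith : 1 ≤ R) x
    have h2 := mul_le_mul_of_nonneg_right hR4 (growth_nonneg ((R ^ 2)⁻¹ • x))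
    linarith
  have hR' : ∀ x : EuclideanSpace ℝ (Fin n), 1 < ‖(R ^ 2)⁻¹ • x‖ → R - 1 ≤ growth x := by
    intro x hx
    rw [norm_smul, Real.norm_of_nonneg hρ0.le, lt_inv_mul_iff₀ (by positivity), mul_one] at hx
    exact le_growth_of_sq_le (by linarith) hx.le
  set ρ := (R ^ 2)⁻¹ with hρ
  set κ := (1 - ε / 2)⁻¹ with hκ
  have hκ0 : 0 < κ := by rw [hκ]; apply inv_pos.2; linarith
  have hκ1 : κ * (1 - ε / 2) = 1 := inv_mul_cancel₀ (by linarith)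
  have htime : ∀ t ∈ Icc (0 : ℝ) 1, 1 - ρ + ρ * t ∈ Icc (1 / 2 : ℝ) 1 := by
    intro t ht
    have h1 := mul_nonneg hρ0.le ht.1
    have h2 := mul_le_of_le_one_right hρ0.le ht.2
    constructor <;> linarith
  have htime' : ∀ t ∈ Icc (0 : ℝ) 1, 1 - ρ + ρ * t ∈ Icc (0 : ℝ) 1 := fun t ht =>
    ⟨by linarith [(htime t ht).1], (htime t ht).2⟩
  refine ⟨?_, ?_, ?_, ?_, ?_⟩
  · have : ContinuousOn ((Function.uncurry v) ∘ fun p : EuclideanSpace ℝ (Fin n) × ℝ =>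
        (ρ • p.1, 1 - ρ + ρ * p.2)) (univ ×ˢ Icc (0 : ℝ) 1) :=
      hv.continuousOn.comp (by fun_prop) (fun p hp => ⟨mem_univ _, htime' _ hp.2⟩)
    exact continuousOn_const.add (continuousOn_const.mul this)
  · obtain ⟨K, hK⟩ := hv.bounded
    refine ⟨|ε / 2 / (1 - ε / 2)| + κ * K, fun x t ht => (abs_add_le _ _).trans ?_⟩
    rw [abs_mul, abs_of_pos hκ0]
    gcongr
    exact hK _ _ (htime' t ht)
  · have := hv.upper.affine (c := ε / 2 / (1 - ε / 2)) (T' := 1) (t₁ := 1 - ρ) hρ0 hκ0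
      (by linarith) (by linarith) 0
    simpa only [zero_add] using this
  · have := hv.lower.affine (c := -(ε / 2 / (1 - ε / 2))) (T' := 1) (t₁ := 1 - ρ) hρ0 hκ0
      (by linarith) (by linarith) 0
    simpa only [zero_add, mul_neg, neg_add] using this
  · intro x t ht
    have h1 := hle (ρ • x) _ (htime t ht)
    have h2 := (_root_.abs_le.1 (hv.abs_le (ρ • x) _ (htime' t ht))).1
    have hgx := mul_le_mul_of_nonneg_left (hg x) hε.le
    have hg0 := mul_nonneg hε.le (growth_nonneg x)
    have hg1 := mul_le_mul_of_nonneg_right hε2 hg0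
    set V := v (ρ • x) (1 - ρ + ρ * t)
    -- Inside the unit ball the bump yields `ε (C + 1)`, which pays for the lift and the gain.
    -- Outside, `growth` drops to a quarter under the zoom while the target keeps at least three
    -- quarters; the difference is at least `ε (R - 1)/2`, which exceeds `ε (C + 1)`.
    have hup : V ≤ (1 - ε) + (1 - ε / 2) * (ε * growth x) := by
      by_cases hx : ‖ρ • x‖ ≤ 1
      · have hb := bump_ge_of_norm_le_one hx
        have hbg : 0 ≤ bumpGain n A l L := by
          by_contra! hneg
          have : bumpGain n A l L * (2 : ℝ)⁻¹ ^ (n + 1) < 0 :=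
            mul_neg_of_neg_of_pos hneg (by positivity)
          have : 0 < ε * (C + 1) := by positivity
          linarith
        have h3 := mul_le_mul_of_nonneg_left hb hbg
        linarith
      · push Not at hx
        have h3 := mul_le_mul_of_nonneg_left (hR' x hx) hε.le
        have hbg : 0 ≤ bumpGain n A l L * bump (ρ • x) := by
          refine mul_nonneg ?_ (bump_pos _).le
          by_contra! hneg
          have : bumpGain n A l L * (2 : ℝ)⁻¹ ^ (n + 1) < 0 :=
            mul_neg_of_neg_of_pos hneg (by positivity)
          have : 0 < ε * (C + 1) := by positivity
          linarith
        have h4 := mul_le_mul_of_nonneg_left hR hε.le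
        linarith
    have e : ε / 2 / (1 - ε / 2) + κ * V = κ * (ε / 2 + V) := by
      rw [hκ]; ring
    rw [e, _root_.abs_le]
    have e2 : 1 + ε * growth x = κ * ((1 - ε / 2) * (1 + ε * growth x)) := by
      rw [← mul_assoc, hκ1, one_mul]
    rw [e2, ← mul_neg]
    constructor
    · refine mul_le_mul_of_nonneg_left ?_ hκ0.le
      linarith
    · refine mul_le_mul_of_nonneg_left ?_ hκ0.le
      linarith

/-- One step of the decay of oscillation. -/
theorem IsTrapped.exists_rescale {R : ℝ} (hn : 1 ≤ n) (hA : 0 ≤ A) (hl : 0 ≤ l) (hL : 0 ≤ L)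
    (hε : 0 < ε) (hε2 : ε ≤ 1 / 2) (hR : 2 * liftRate n A L + 4 ≤ R)
    (hεm : ε * (liftRate n A L + 1) ≤ bumpGain n A l L * (2 : ℝ)⁻¹ ^ (n + 1))
    (hv : IsTrapped A l L ε v) :
    ∃ c, IsTrapped A l L ε (fun x t => c + (1 - ε / 2)⁻¹ *
      v ((R ^ 2)⁻¹ • x) (1 - (R ^ 2)⁻¹ + (R ^ 2)⁻¹ * t)) := by
  rcases hv.deficit_dichotomy hε.le with h | h
  · exact ⟨_, hv.rescale_of_le hA hL hε hε2 hR hεm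
      fun x t ht => hv.le_sub_bump hn hA hl hL hε h x ht⟩
  · have := (hv.neg.rescale_of_le hA hL hε hε2 hR hεm
      fun x t ht => hv.neg.le_sub_bump hn hA hl hL hε h x ht).neg
    exact ⟨_, by simpa only [mul_neg, neg_add, neg_neg] using this⟩

/-- Rescaling fixes `(0,1)`, turns scale `ρ^{k+1}` into `ρ^k`, and its additive constant cancels in
differences. The induction must range over all trapped `v`, as each step changes the function. The
constant `4` comes from `|v| ≤ 2` on the unit ball. -/
theorem IsTrapped.abs_sub_le_pow {R : ℝ} (hn : 1 ≤ n) (hA : 0 ≤ A) (hl : 0 ≤ l) (hL : 0 ≤ L)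
    (hε : 0 < ε) (hε2 : ε ≤ 1 / 2) (hR : 2 * liftRate n A L + 4 ≤ R)
    (hεm : ε * (liftRate n A L + 1) ≤ bumpGain n A l L * (2 : ℝ)⁻¹ ^ (n + 1)) (k : ℕ) :
    ∀ v : EuclideanSpace ℝ (Fin n) → ℝ → ℝ, IsTrapped A l L ε v →
      ∀ x, ∀ s ∈ Icc (0 : ℝ) 1, ‖x‖ ≤ (R ^ 2)⁻¹ ^ k → 1 - s ≤ (R ^ 2)⁻¹ ^ k →
        |v x s - v 0 1| ≤ 4 * (1 - ε / 2) ^ k := by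
  have hC := liftRate_pos (n := n) hA hL
  have hρ0 : 0 < (R ^ 2)⁻¹ := by
    have : 0 < R := by linarith
    positivity
  have hρ1 : (R ^ 2)⁻¹ ≤ 1 := inv_le_one_of_one_le₀ (by nlinarith)
  set ρ := (R ^ 2)⁻¹ with hρ
  induction k with
  | zero =>
    intro v hv x s hs hx _
    rw [pow_zero] at hx
    have hb : ∀ x : EuclideanSpace ℝ (Fin n), ‖x‖ ≤ 1 → ∀ s ∈ Icc (0 : ℝ) 1, |v x s| ≤ 2 := by
      intro x hx s hs
      refine (hv.abs_le x s hs).trans ?_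
      have h1 := (growth_le_norm x).trans hx
      have h2 := mul_le_mul_of_nonneg_left h1 hε.le
      linarith
    have h1 := _root_.abs_le.1 (hb x hx s hs)
    have h2 := _root_.abs_le.1 (hb 0 (by simp) 1 (by simp))
    rw [pow_zero, _root_.abs_le]
    constructor <;> linarith [h1.1, h1.2, h2.1, h2.2]
  | succ k ih =>
    intro v hv x s hs hx hs'
    obtain ⟨c, hc⟩ := hv.exists_rescale hn hA hl hL hε hε2 hR hεm
    rw [pow_succ] at hx hs'
    have hpk : ρ ^ k ≤ 1 := pow_le_one₀ hρ0.le hρ1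
    have h := ih _ hc (ρ⁻¹ • x) ((s - (1 - ρ)) / ρ)
      ⟨div_nonneg (by nlinarith) hρ0.le, by rw [div_le_one hρ0]; linarith [hs.2]⟩
      (by
        rw [norm_smul, Real.norm_of_nonneg (inv_nonneg.2 hρ0.le), inv_mul_le_iff₀ hρ0]
        linarith)
      (by
        rw [show 1 - (s - (1 - ρ)) / ρ = (1 - s) / ρ by field_simp; ring, div_le_iff₀ hρ0]
        exact hs')
    rw [← hρ, smul_smul, mul_inv_cancel₀ hρ0.ne', one_smul, smul_zero, mul_one,
      show 1 - ρ + ρ * ((s - (1 - ρ)) / ρ) = s by field_simp; ring,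
      show 1 - ρ + ρ = 1 by ring, add_sub_add_left_eq_sub, ← mul_sub, abs_mul,
      abs_of_pos (inv_pos.2 (by linarith)), inv_mul_le_iff₀ (by linarith)] at h
    rw [pow_succ]
    linarith

theorem bumpGain_pos (hl : 0 < l) : 0 < bumpGain n A l L := by
  have : 0 < volume.real (Metric.closedBall (0 : EuclideanSpace ℝ (Fin n)) 1) :=
    ENNReal.toReal_pos (Metric.measure_closedBall_pos _ _ one_pos).ne'
      (isCompact_closedBall _ _).measure_lt_top.ne
  unfold bumpGain gainRate
  positivity

/-- Solutions on `[0,1]` bounded by `1` are Hölder continuous at the point `(0,1)`. -/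
theorem exists_holder_exponent (hn : 1 ≤ n) (hA : 0 ≤ A) (hl : 0 < l) (hL : 0 ≤ L) :
    ∃ α ε : ℝ, 0 < α ∧ α < 1 ∧ 0 < ε ∧
      ∀ v : EuclideanSpace ℝ (Fin n) → ℝ → ℝ, IsTrapped A l L ε v →
        (∀ x, ∀ t ∈ Icc (0 : ℝ) 1, |v x t| ≤ 1) →
        ∀ x, ∀ s ∈ Icc (0 : ℝ) 1, |v x s - v 0 1| ≤ 8 * (‖x‖ ^ α + (1 - s) ^ α) := by
  have hC := liftRate_pos (n := n) hA hL
  have hb := bumpGain_pos (n := n) (A := A) (L := L) hl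
  set C := liftRate n A L with hCdef
  set R := 2 * C + 4 with hR
  set ε := min (1 / 2) (bumpGain n A l L * (2 : ℝ)⁻¹ ^ (n + 1) / (C + 1)) with hεdef
  have hε : 0 < ε := lt_min (by norm_num) (by positivity)
  have hε2 : ε ≤ 1 / 2 := min_le_left _ _
  have hεm : ε * (C + 1) ≤ bumpGain n A l L * (2 : ℝ)⁻¹ ^ (n + 1) := by
    rw [← le_div_iff₀ (by positivity)]
    exact min_le_right _ _
  set ρ := (R ^ 2)⁻¹ with hρ
  have hρ0 : 0 < ρ := by positivity
  have hρ1 : ρ < 1 / 2 := by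
    rw [hρ, inv_lt_comm₀ (by positivity) (by norm_num)]; norm_num; nlinarith
  set q := 1 - ε / 2 with hq
  have hq1 : q < 1 := by linarith
  have hq2 : 1 / 2 < q := by linarith
  -- Chosen so that `ρ^α = q`: one zoom matches one step of decay. Since `ρ < 1/2 < q < 1`, the
  -- exponent lies in `(0,1)`.
  set α := Real.logb ρ q with hα
  have hρα : ρ ^ α = q := Real.rpow_logb hρ0 (by linarith) (by linarith)
  have hα0 : 0 < α := by
    by_contra! h
    have := Real.one_le_rpow_of_pos_of_le_one_of_nonpos hρ0 (by linarith) h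
    linarith
  have hα1 : α < 1 := by
    by_contra! h
    have := Real.rpow_le_rpow_of_exponent_ge hρ0 (by linarith) h
    rw [Real.rpow_one] at this
    linarith
  refine ⟨α, ε, hα0, hα1, hε, fun v hv hv1 x s hs => ?_⟩
  have hs1 : 0 ≤ 1 - s := by linarith [hs.2]
  set d := max ‖x‖ (1 - s) with hd
  have hx0 : 0 ≤ ‖x‖ ^ α := by positivity
  have hs0 : 0 ≤ (1 - s) ^ α := Real.rpow_nonneg hs1 _
  have hdα : d ^ α ≤ ‖x‖ ^ α + (1 - s) ^ α := by
    rcases max_choice ‖x‖ (1 - s) with h | h <;> rw [hd, h] <;> linarith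
  rcases (le_max_of_le_left (norm_nonneg x) : 0 ≤ d).eq_or_lt with h0 | h0
  · have h1 : ‖x‖ ≤ 0 := by rw [h0]; exact le_max_left _ _
    have h2 : 1 - s ≤ 0 := by rw [h0]; exact le_max_right _ _
    have h3 : x = 0 := norm_le_zero_iff.1 h1
    have h4 : s = 1 := by linarith [hs.2]
    rw [h3, h4, sub_self, abs_zero]
    have := Real.rpow_nonneg (sub_self (1 : ℝ)).ge α
    positivity
  rcases le_or_gt d 1 with h1 | h1
  -- With `ρ^{k+1} < d ≤ ρ^k` one gets `d^α ≥ q^{k+1} ≥ q^k/2`, which turns the constant `4` into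
  -- `8`.
  · obtain ⟨k, hk1, hk2⟩ := exists_nat_pow_near_of_lt_one h0 h1 hρ0 (by linarith)
    have h2 := IsTrapped.abs_sub_le_pow hn hA hl.le hL hε hε2 le_rfl hεm k v hv x s hs
      ((le_max_left _ _).trans hk2) ((le_max_right _ _).trans hk2)
    have h3 : q ^ (k + 1) ≤ d ^ α := by
      rw [← hρα, Real.rpow_pow_comm hρ0.le]
      exact Real.rpow_le_rpow (by positivity) hk1.le hα0.le
    rw [pow_succ] at h3
    have h4 : 0 < q ^ k := by positivity
    have h5 : q ^ k * (1 / 2) ≤ q ^ k * q := by gcongr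
    rw [← hq] at h2
    linarith
  -- As `1 - s ≤ 1`, only the space distance can exceed `1`, and then the trivial bound `2`
  -- suffices.
  · have hx1 : 1 ≤ ‖x‖ := by
      rcases lt_max_iff.1 h1 with h | h
      · exact h.le
      · linarith [hs.1]
    have h2 := Real.one_le_rpow hx1 hα0.le
    have e1 := _root_.abs_le.1 (hv1 x s hs)
    have e2 := _root_.abs_le.1 (hv1 0 1 (by simp))
    rw [_root_.abs_le]
    constructor <;> linarith [e1.1, e1.2, e2.1, e2.2]

end Oscillation

/-! ### Scaling to arbitrary points and conclusion. -/

theorem abs_sub_le_of_holder_exponent {n : ℕ} {A l L α ε : ℝ} (hε : 0 < ε)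
    (hα : ∀ v : EuclideanSpace ℝ (Fin n) → ℝ → ℝ, IsTrapped A l L ε v →
      (∀ x, ∀ t ∈ Icc (0 : ℝ) 1, |v x t| ≤ 1) →
      ∀ x, ∀ s ∈ Icc (0 : ℝ) 1, |v x s - v 0 1| ≤ 8 * (‖x‖ ^ α + (1 - s) ^ α))
    {T M : ℝ} (hM : 0 < M) {u : EuclideanSpace ℝ (Fin n) → ℝ → ℝ}
    (hcont : ContinuousOn (Function.uncurry u) (univ ×ˢ Icc (0 : ℝ) T))
    (huM : ∀ x, ∀ t ∈ Icc (0 : ℝ) T, |u x t| ≤ M)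
    (hup : TouchBound A l L T u) (hlow : TouchBound A l L T (fun x t => -u x t))
    {t : ℝ} (ht : 0 < t) (htT : t ≤ T) (x y : EuclideanSpace ℝ (Fin n)) {s : ℝ}
    (hs : s ∈ Icc (0 : ℝ) t) :
    |u x t - u y s| ≤ 8 * M * ((‖x - y‖ ^ α + |t - s| ^ α) / t ^ α) := by
  -- Moves `(x,t)` to `(0,1)` and normalises the bound to `1`; the scale `t` becomes the denominator
  -- `t^α`.
  set v : EuclideanSpace ℝ (Fin n) → ℝ → ℝ := fun ξ τ => M⁻¹ * u (x + t • ξ) (t * τ) with hv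
  have htime : ∀ τ ∈ Icc (0 : ℝ) 1, t * τ ∈ Icc (0 : ℝ) T := fun τ hτ =>
    ⟨mul_nonneg ht.le hτ.1, (mul_le_of_le_one_right ht.le hτ.2).trans htT⟩
  have hv1 : ∀ ξ, ∀ τ ∈ Icc (0 : ℝ) 1, |v ξ τ| ≤ 1 := by
    intro ξ τ hτ
    rw [hv]
    simp only
    rw [abs_mul, abs_of_pos (inv_pos.2 hM), inv_mul_le_iff₀ hM, mul_one]
    exact huM _ _ (htime τ hτ)
  have htr : IsTrapped A l L ε v := by
    refine ⟨?_, ⟨1, hv1⟩, ?_, ?_, fun ξ τ hτ => (hv1 ξ τ hτ).trans ?_⟩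
    · have : ContinuousOn ((Function.uncurry u) ∘ fun p : EuclideanSpace ℝ (Fin n) × ℝ =>
          (x + t • p.1, t * p.2)) (univ ×ˢ Icc (0 : ℝ) 1) :=
        hcont.comp (by fun_prop) (fun p hp => ⟨mem_univ _, htime _ hp.2⟩)
      exact continuousOn_const.mul this
    · have := hup.affine (c := 0) (T' := 1) (t₁ := 0) ht (inv_pos.2 hM) le_rfl (by linarith) x
      simpa only [zero_add] using this
    · have := hlow.affine (c := 0) (T' := 1) (t₁ := 0) ht (inv_pos.2 hM) le_rfl (by linarith) x
      simpa only [zero_add, mul_neg] using this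
    · have := mul_nonneg hε.le (growth_nonneg ξ)
      linarith
  have h := hα v htr hv1 (t⁻¹ • (y - x)) (s / t)
    ⟨div_nonneg hs.1 ht.le, (div_le_one ht).2 hs.2⟩
  have e1 : v (t⁻¹ • (y - x)) (s / t) - v 0 1 = M⁻¹ * (u y s - u x t) := by
    simp only [hv]
    rw [smul_smul, mul_inv_cancel₀ ht.ne', one_smul, mul_div_cancel₀ _ ht.ne', smul_zero,
      add_zero, mul_one, add_sub_cancel, mul_sub]
  have e2 : ‖t⁻¹ • (y - x)‖ ^ α = ‖x - y‖ ^ α / t ^ α := by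
    rw [norm_smul, Real.norm_of_nonneg (inv_nonneg.2 ht.le), norm_sub_rev, inv_mul_eq_div,
      Real.div_rpow (norm_nonneg _) ht.le]
  have hst : 0 ≤ t - s := by linarith [hs.2]
  have e3 : (1 - s / t) ^ α = |t - s| ^ α / t ^ α := by
    rw [one_sub_div ht.ne', Real.div_rpow hst ht.le, abs_of_nonneg hst]
  rw [e1, e2, e3, abs_mul, abs_of_pos (inv_pos.2 hM), inv_mul_le_iff₀ hM, ← add_div] at h
  rw [abs_sub_comm]
  linarith


theorem theoremt (n : ℕ) (hn : 1 ≤ n) (A l L : ℝ) (hA : 0 ≤ A) (hl : 0 < l) (hlL : l ≤ L) :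
    ∃ α C : ℝ, 0 < α ∧ α < 1 ∧ 0 < C ∧
      ∀ (T : ℝ), 0 < T → ∀ u : EuclideanSpace ℝ (Fin n) → ℝ → ℝ,
        ContinuousOn (Function.uncurry u) (Set.univ ×ˢ Set.Icc (0 : ℝ) T) →
        (∃ K : ℝ, ∀ x, ∀ t ∈ Set.Icc (0 : ℝ) T, |u x t| ≤ K) →
        IsViscositySubsolution A l L T u →
        IsViscositySupersolution A l L T u →
        ∀ t : ℝ, 0 < t → t ≤ T →
          (∀ x y, ∀ s ∈ Set.Icc (0 : ℝ) t,
            |u x t - u y s| ≤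
              C * (⨆ z, |u z 0|) * ((‖x - y‖ ^ α + |t - s| ^ α) / t ^ α)) ∧
          (∀ x, ∀ s ∈ Set.Icc (t / 2) t, |u x s| ≤ C * ⨆ z, |u z 0|) ∧
          (∀ x y, ∀ s ∈ Set.Icc (t / 2) t, ∀ s' ∈ Set.Icc (t / 2) t,
            |u x s - u y s'| ≤
              C / t ^ α * (⨆ z, |u z 0|) * (‖x - y‖ ^ α + |s - s'| ^ α)) := by

  have hL : 0 < L := hl.trans_le hlL
  obtain ⟨α, ε, hα0, hα1, hε, hα⟩ := exists_holder_exponent (n := n) hn hA hl hL.le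
  refine ⟨α, 16, hα0, hα1, by norm_num, ?_⟩
  intro T hT u hcont hbdd hsub hsup t ht htT
  have hup := hsub.touchBound hA hl.le hlL hn hcont hbdd
  have hcont' : ContinuousOn (Function.uncurry fun x t => -u x t) (univ ×ˢ Icc (0 : ℝ) T) :=
    hcont.neg
  have hbdd' : ∃ K : ℝ, ∀ x, ∀ t ∈ Icc (0 : ℝ) T, |-u x t| ≤ K := by simpa using hbdd
  have hlow := hsup.neg.touchBound hA hl.le hlL hn hcont' hbdd'
  set M := ⨆ z, |u z 0| with hM
  -- Boundedness of `u` is essential: the supremum of an unbounded real family is `0` by convention.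
  have hM0 : ∀ z, |u z 0| ≤ M := by
    obtain ⟨K, hK⟩ := hbdd
    refine fun z => le_ciSup (f := fun z => |u z 0|) ⟨K, ?_⟩ z
    rintro _ ⟨z, rfl⟩
    exact hK z 0 ⟨le_rfl, hT.le⟩
  have hMnn : 0 ≤ M := (abs_nonneg _).trans (hM0 0)
  have huM : ∀ x, ∀ t ∈ Icc (0 : ℝ) T, |u x t| ≤ M := by
    intro x t ht
    have h1 := hup.le_of_initial hn hA hl.le hL.le hcont hbdd
      (fun z => (abs_le.1 (hM0 z)).2) x ht
    have h2 := hlow.le_of_initial hn hA hl.le hL.le hcont' hbdd' (M := M)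
      (fun z => by linarith [(abs_le.1 (hM0 z)).1]) x ht
    exact abs_le.2 ⟨by linarith, h1⟩
  have key : ∀ t, 0 < t → t ≤ T → ∀ x y, ∀ s ∈ Icc (0 : ℝ) t,
      |u x t - u y s| ≤ 8 * M * ((‖x - y‖ ^ α + |t - s| ^ α) / t ^ α) := by
    intro t ht htT x y s hs
    -- Normalisation by `M` is impossible when `M = 0`, but then `u` vanishes.
    rcases hMnn.eq_or_lt with h0 | h0
    · have h1 := abs_nonpos_iff.1 ((huM x t ⟨ht.le, htT⟩).trans_eq h0.symm)
      have h2 := abs_nonpos_iff.1 ((huM y s ⟨hs.1, hs.2.trans htT⟩).trans_eq h0.symm)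
      rw [h1, h2, ← h0]
      simp
    · exact abs_sub_le_of_holder_exponent hε hα h0 hcont huM hup hlow ht htT x y hs
  -- The first estimate applied at the later of the two times; `t^α ≤ 2 s^α` for `s ≥ t/2` doubles
  -- the constant to `16`.
  have hmid : ∀ s, t / 2 ≤ s → s ≤ t → ∀ x y, ∀ s' ∈ Icc (0 : ℝ) s,
      |u x s - u y s'| ≤ 16 / t ^ α * M * (‖x - y‖ ^ α + |s - s'| ^ α) := by
    intro s hs hst x y s' hs'
    have hs0 : 0 < s := by linarith
    refine (key s hs0 (hst.trans htT) x y s' hs').trans ?_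
    have htα : 0 < t ^ α := by positivity
    have hsα : 0 < s ^ α := by positivity
    have h1 : t ^ α ≤ 2 * s ^ α := by
      calc t ^ α ≤ (2 * s) ^ α := Real.rpow_le_rpow ht.le (by linarith) hα0.le
        _ = 2 ^ α * s ^ α := Real.mul_rpow (by norm_num) hs0.le
        _ ≤ 2 ^ (1 : ℝ) * s ^ α := by
            gcongr
            norm_num
        _ = 2 * s ^ α := by rw [Real.rpow_one]
    have h2 : 1 / s ^ α ≤ 2 / t ^ α := by
      rw [div_le_div_iff₀ hsα htα]
      linarith
    set D := ‖x - y‖ ^ α + |s - s'| ^ α with hD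
    have hD0 : 0 ≤ D := by positivity
    calc 8 * M * (D / s ^ α) = 8 * M * D * (1 / s ^ α) := by ring
      _ ≤ 8 * M * D * (2 / t ^ α) := by gcongr
      _ = 16 / t ^ α * M * D := by ring
  refine ⟨fun x y s hs => ?_, fun x s hs => ?_, fun x y s hs s' hs' => ?_⟩
  · refine (key t ht htT x y s hs).trans ?_
    gcongr
    norm_num
  · refine (huM x s ⟨by linarith [hs.1], hs.2.trans htT⟩).trans ?_
    linarith
  · rcases le_total s' s with h | h
    · exact hmid s hs.1 hs.2 x y s' ⟨by linarith [hs'.1], h⟩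
    · have := hmid s' hs'.1 hs'.2 y x s ⟨by linarith [hs.1], h⟩
      rwa [abs_sub_comm, norm_sub_rev y x, abs_sub_comm s' s] at this
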